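/- **Theorem 4.2 (convergence on high-frequency bandlimited noise models).** Let $L,\alpha_0,\gamma>0$, let $\xi_1,\dots,\xi_d$ be an orthonormal basis of $\mathbb R^d$, and let $\varepsilon:\mathbb R^d\to\mathbb R$ be a uniformly continuous function such that for all $x\in\mathbb R^d$ and $i\in\{1,\dots,d\}$ the cross section $\eta(y)=\varepsilon(x+y\,\xi_i)$ is a high-frequency bandlimited signal: it is continuous, $\int_{\mathbb R}|\eta|<\infty$, and its Fourier transform $\widehat\eta(u)=\int_{\mathbb R}\eta(y)e^{-2\pi i u y}\,dy$ satisfies $\widehat\eta(u)=0$ for $u\in(-\alpha_0,\alpha_0)$ and $|\widehat\eta(u)|\le\gamma$ for all $u\in\mathbb R$. For $M\ge 1$, $\sigma>0$ and $F:\mathbb R^d\to\mathbb R$, the directional Gaussian smoothing (DGS) gradient with $M$-point Gauss–Hermite quadrature and smoothing radius $\sigma$ is $$\widetilde\nabla^M_\sigma[F](x)=\sum_{i=1}^d\Big(\frac1{\sqrt\pi\,\sigma}\sum_{m=1}^M w_m\,F(x+\sqrt2\,\sigma v_m\xi_i)\,\sqrt2\,v_m\Big)\xi_i ,$$ where $v_1,\dots,v_M$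 are the roots of the $M$-th Hermite polynomial (orthogonal for the weight $e^{-v^2}$) and $w_1,\dots,w_M$ are the Gauss–Hermite weights. Then there is a constant $C>0$, depending only on $\varepsilon$, $(\xi_i)$, $L$, $\alpha_0$, $\gamma$, such that the following holds for every $\tau>0$, every continuously differentiable $\phi:\mathbb R^d\to\mathbb R$ with $\|\nabla\phi(x)-\nabla\phi(y)\|\le L\|x-y\|$ and $\phi(y)\ge\phi(x)+\langle\nabla\phi(x),y-x\rangle+\frac\tau2\|y-x\|^2$ for all $x,y\in\mathbb R^d$, with $x^*$ the global minimum of $\phi$, and for every integer $M\ge2$. For $\sigma>0$ put $$\delta_\sigma=\Big(\frac4{\tau^2}+\frac1{4L\tau}\Big)\Big(\frac{C\pi (M!)^2d}{4^M((2M)!)^2}\sigma^{4M-2}+48L^2d\,\sigma^2+\frac{3\gamma^2d}{\pi^2\sigma^4}e^{-4\pi^2\alpha_0^2\sigma^2}\Big).$$ 1. For every $\sigma>0$ and every sequence with $x_{t+1}=x_t-\frac1{16L}\widetilde\nabla^M_\sigma[\phi+\varepsilon](x_t)$, $t\ge0$ (with arbitrary $x_0\in\mathbb R^d$), we have for all $t\ge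 0$ $$\|x_{t+1}-x^*\|^2\le\Big(1-\frac\tau{32L}\Big)^{t+1}\|x_0-x^*\|^2+\delta_\sigma .$$ 2. If $\alpha_0>L^{1/3}/(\pi\gamma^{1/3})$ and $\ell=\log\big(\pi\alpha_0\gamma^{1/3}/L^{1/3}\big)$, then for $\sigma=\frac{\sqrt3}{\pi\alpha_0\sqrt2}\,\ell^{1/2}>0$ $$\delta_\sigma\le\Big(\frac4{\tau^2}+\frac1{4L\tau}\Big)\Big[\frac{C\pi (M!)^2d}{4^M((2M)!)^2}\sigma^{4M-2}+\frac{8L^2d}{\alpha_0^2}\big(\ell+\ell^{-2}\big)\Big].$$ 3. If $\alpha_0\le L^{1/3}/(\pi\gamma^{1/3})$, then for $\sigma=1/\alpha_0$ $$\delta_\sigma\le\Big(\frac4{\tau^2}+\frac1{4L\tau}\Big)\Big[\frac{C\pi (M!)^2d}{4^M((2M)!)^2}\sigma^{4M-2}+\frac{49L^2d}{\alpha_0^2}\Big].$$ -/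

import Mathlib

open scoped FourierTransform

noncomputable section

/-- The Euclidean space `ℝ^d`. -/
abbrev EucSp (d : ℕ) : Type := EuclideanSpace ℝ (Fin d)

/-- The one-dimensional cross section `y ↦ f (x + y ξ)` of `f` at `x` in the direction `ξ`. -/
def crossSection {d : ℕ} (f : EucSp d → ℝ) (x ξ : EucSp d) (y : ℝ) : ℝ :=
  f (x + y • ξ)

/-- A high-frequency bandlimited signal: a continuous, absolutely integrable real function whose
Fourier transform `u ↦ ∫ f y * exp (-2 π i u y) dy` vanishes on `(-α₀, α₀)` and is bounded
by `γ`. -/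
structure IsHighFreqBandlimited (α₀ γ : ℝ) (f : ℝ → ℝ) : Prop where
  continuous : Continuous f
  integrable : MeasureTheory.Integrable f
  vanish : ∀ u ∈ Set.Ioo (-α₀) α₀, 𝓕 (fun y : ℝ => (f y : ℂ)) u = 0
  bounded : ∀ u : ℝ, ‖𝓕 (fun y : ℝ => (f y : ℂ)) u‖ ≤ γ

/-- `φ` is continuously differentiable with `L`-Lipschitz gradient. -/
def HasLipschitzGradient {d : ℕ} (L : ℝ) (φ : EucSp d → ℝ) : Prop :=
  ContDiff ℝ 1 φ ∧ ∀ x y : EucSp d, ‖gradient φ x - gradient φ y‖ ≤ L * ‖x - y‖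

/-- The first-order strong convexity inequality with parameter `τ`. -/
def IsStronglyConvexGrad {d : ℕ} (τ : ℝ) (φ : EucSp d → ℝ) : Prop :=
  ∀ x y : EucSp d, φ x + inner ℝ (gradient φ x) (y - x) + τ / 2 * ‖y - x‖ ^ 2 ≤ φ y

/-- The Hermite polynomial `H_M` in the normalization orthogonal for the weight `exp (-v²)`:
`H_M (v) = 2^(M/2) He_M (√2 v)`, with `He_M` Mathlib's polynomial `Polynomial.hermite M`
(orthogonal for the weight `exp (-v²/2)`). -/
def hermiteH (M : ℕ) : Polynomial ℝ :=
  Polynomial.C (Real.sqrt 2 ^ M) *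
    ((Polynomial.hermite M).map (Int.castRingHom ℝ)).comp
      (Polynomial.C (Real.sqrt 2) * Polynomial.X)

/-- The Gauss-Hermite nodes: the real roots of `H_M`. -/
def ghNodes (M : ℕ) : Finset ℝ := (hermiteH M).roots.toFinset

/-- The Gauss-Hermite quadrature weight of the node `v`: the integral against `exp (-s²) ds` of
the Lagrange basis polynomial that is `1` at `v` and `0` at the other nodes. -/
def ghWeight (M : ℕ) (v : ℝ) : ℝ :=
  ∫ s : ℝ, (Lagrange.basis (ghNodes M) id v).eval s * Real.exp (-s ^ 2)

/-- The `M`-point Gauss-Hermite estimator, with smoothing radius `σ`, of the derivative at `0` of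
the Gaussian smoothing of `G`. -/
def ghDeriv (M : ℕ) (σ : ℝ) (G : ℝ → ℝ) : ℝ :=
  1 / (Real.sqrt Real.pi * σ) *
    ∑ v ∈ ghNodes M, ghWeight M v * G (Real.sqrt 2 * σ * v) * (Real.sqrt 2 * v)

/-- The estimated directional Gaussian smoothing (DGS) gradient of `F` at `x`: the vector whose
coordinate along each `ξ i` is the Gauss-Hermite estimator for the cross section along `ξ i`. -/
def dgsGradient {d : ℕ} (M : ℕ) (σ : ℝ) (ξ : OrthonormalBasis (Fin d) ℝ (EucSp d))
    (F : EucSp d → ℝ) (x : EucSp d) : EucSp d :=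
  ∑ i, ghDeriv M σ (crossSection F x (ξ i)) • ξ i

/-- `x` is generated by DGS gradient descent with step size `lam` and smoothing radius `σ`. -/
def IsDGSDescent {d : ℕ} (lam : ℝ) (M : ℕ) (σ : ℝ)
    (ξ : OrthonormalBasis (Fin d) ℝ (EucSp d)) (F : EucSp d → ℝ) (x : ℕ → EucSp d) : Prop :=
  ∀ t : ℕ, x (t + 1) = x t - lam • dgsGradient M σ ξ F (x t)

/-- The quadrature contribution `C π (M!)² d σ^(4M-2) / (4^M ((2M)!)²)`. -/
def ghTerm (C : ℝ) (d M : ℕ) (σ : ℝ) : ℝ :=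
  C * Real.pi * (M.factorial : ℝ) ^ 2 * (d : ℝ) / (4 ^ M * ((2 * M).factorial : ℝ) ^ 2)
    * σ ^ (4 * M - 2)

/-- The squared radius `δ_σ` of the neighborhood of convergence. -/
def deltaSigma (C L τ α₀ γ : ℝ) (d M : ℕ) (σ : ℝ) : ℝ :=
  (4 / τ ^ 2 + 1 / (4 * L * τ)) *
    (ghTerm C d M σ + 48 * L ^ 2 * (d : ℝ) * σ ^ 2
      + 3 * γ ^ 2 * (d : ℝ) / (Real.pi ^ 2 * σ ^ 4)
        * Real.exp (-(4 * Real.pi ^ 2 * α₀ ^ 2 * σ ^ 2)))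

/-- The logarithmic factor `log (π α₀ γ^(1/3) / L^(1/3))`. -/
def logFactor (L α₀ γ : ℝ) : ℝ :=
  Real.log (Real.pi * α₀ * γ ^ (1 / 3 : ℝ) / L ^ (1 / 3 : ℝ))

end

open Polynomial MeasureTheory

/-! ### Gaussian integrals of polynomials -/

/-! The iteration is inexact gradient descent on `φ`. One step with length `1 / (16 L)` contracts
the squared distance to the minimizer, up to a multiple of the squared gradient error
(`norm_inexact_step_sub_sq_le`). It remains to bound that error in each direction `ξ i`, where it
splits into a smooth part and a noise part.

Smooth part: for `M ≥ 2` the quadrature differentiates affine functions exactly, so only the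
quadratic Taylor remainder of `φ` contributes, at most `L σ`
(`abs_ghDeriv_crossSection_sub_inner_le`). Positive weights and bounded low moments make this
uniform in `M`.

Noise part: by Fourier inversion a cross section is a superposition of exponentials with frequencies
at least `α₀`. On an exponential, the quadrature is the exact Gaussian integral plus an error. The
exact part decays like a Gaussian in the frequency and produces the exponential term of `δ_σ`
(`abs_ghDeriv_sub_le`). The transform is not assumed integrable, so inversion is applied to a
mollified signal; uniform continuity of `ε` makes the replacement cost uniform over all cross
sections.

No quadrature rate in `M` is needed: `C` may depend on `ε`. For small `σ` the exponential term
dominates a crude bound, for large `σ` the term in `L² σ²` does. On the remaining compact range the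
quadrature error is negligible for large `M`, and `C` absorbs the finitely many other `M`
(`exists_forall_ghDeriv_sq_le`). -/

theorem integrable_pow_mul_exp_neg_sq (n : ℕ) :
    Integrable fun s : ℝ => s ^ n * Real.exp (-s ^ 2) := by
  have h := integrable_rpow_mul_exp_neg_mul_sq (b := 1) one_pos (s := n)
    (by have : (0 : ℝ) ≤ n := n.cast_nonneg
        linarith)
  simpa [Real.rpow_natCast] using h

theorem integrable_eval_mul_exp_neg_sq (p : ℝ[X]) :
    Integrable fun s : ℝ => p.eval s * Real.exp (-s ^ 2) := by
  induction p using Polynomial.induction_on' with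
  | add p q hp hq =>
    simp only [eval_add, add_mul]
    exact hp.add hq
  | monomial n a =>
    simpa [mul_assoc] using (integrable_pow_mul_exp_neg_sq n).const_mul a

/-- The derivative of `p e^(-s²)` has integral zero. This one identity yields both the moment
recursion and the orthogonality of the Hermite polynomials. -/
theorem integral_derivative_mul_exp_neg_sq (p : ℝ[X]) :
    ∫ s : ℝ, (derivative p).eval s * Real.exp (-s ^ 2) =
      ∫ s : ℝ, (2 * X * p).eval s * Real.exp (-s ^ 2) := by
  have hd : ∀ s : ℝ, HasDerivAt (fun s => p.eval s * Real.exp (-s ^ 2))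
      ((derivative p).eval s * Real.exp (-s ^ 2)
        - (2 * X * p).eval s * Real.exp (-s ^ 2)) s := by
    intro s
    have h1 : HasDerivAt (fun s : ℝ => Real.exp (-s ^ 2)) (Real.exp (-s ^ 2) * -(2 * s)) s := by
      simpa using ((hasDerivAt_pow 2 s).neg).exp
    refine ((p.hasDerivAt s).mul h1).congr_deriv ?_
    simp only [eval_mul, eval_X, eval_ofNat]
    ring
  have h := integral_eq_zero_of_hasDerivAt_of_integrable hd
    ((integrable_eval_mul_exp_neg_sq _).sub (integrable_eval_mul_exp_neg_sq _))
    (integrable_eval_mul_exp_neg_sq p)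
  rw [integral_sub (integrable_eval_mul_exp_neg_sq _) (integrable_eval_mul_exp_neg_sq _)] at h
  linarith

theorem integral_exp_neg_sq : ∫ s : ℝ, Real.exp (-s ^ 2) = Real.sqrt Real.pi := by
  simpa using integral_gaussian 1

theorem integral_even_pow_succ_mul_exp_neg_sq (m : ℕ) :
    ∫ s : ℝ, s ^ (2 * (m + 1)) * Real.exp (-s ^ 2) =
      (m + 1 / 2) * ∫ s : ℝ, s ^ (2 * m) * Real.exp (-s ^ 2) := by
  have h := integral_derivative_mul_exp_neg_sq (X ^ (2 * m + 1))
  have e1 : ∀ s : ℝ, (derivative (X ^ (2 * m + 1) : ℝ[X])).eval s * Real.exp (-s ^ 2) =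
      (2 * m + 1) * (s ^ (2 * m) * Real.exp (-s ^ 2)) := by
    intro s
    rw [derivative_X_pow]
    simp
    ring
  have e2 : ∀ s : ℝ, (2 * X * X ^ (2 * m + 1) : ℝ[X]).eval s * Real.exp (-s ^ 2) =
      2 * (s ^ (2 * (m + 1)) * Real.exp (-s ^ 2)) := by
    intro s
    simp only [eval_mul, eval_X, eval_ofNat, eval_pow]
    ring
  simp_rw [e1, e2, integral_const_mul] at h
  linarith

theorem integral_even_pow_mul_exp_neg_sq_le (m : ℕ) :
    ∫ s : ℝ, s ^ (2 * m) * Real.exp (-s ^ 2) ≤ Real.sqrt Real.pi * m.factorial := by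
  induction m with
  | zero => simp [integral_exp_neg_sq]
  | succ m ih =>
    rw [integral_even_pow_succ_mul_exp_neg_sq, Nat.factorial_succ]
    push_cast
    have : (0 : ℝ) ≤ Real.sqrt Real.pi * m.factorial := by positivity
    have hm : (0 : ℝ) ≤ m := m.cast_nonneg
    nlinarith [mul_le_mul_of_nonneg_left ih (by linarith : (0 : ℝ) ≤ m + 1 / 2)]

theorem integral_sq_mul_exp_neg_sq :
    ∫ s : ℝ, s ^ 2 * Real.exp (-s ^ 2) = Real.sqrt Real.pi / 2 := by
  have h := integral_even_pow_succ_mul_exp_neg_sq 0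
  simp [integral_exp_neg_sq] at h
  linarith

theorem integral_pow_four_mul_exp_neg_sq :
    ∫ s : ℝ, s ^ 4 * Real.exp (-s ^ 2) = 3 / 4 * Real.sqrt Real.pi := by
  have h := integral_even_pow_succ_mul_exp_neg_sq 1
  norm_num [integral_sq_mul_exp_neg_sq] at h
  linarith

/-! ### Hermite polynomials -/

theorem hermiteH_zero : hermiteH 0 = 1 := by simp [hermiteH]

theorem hermiteH_succ (n : ℕ) :
    hermiteH (n + 1) = 2 * X * hermiteH n - derivative (hermiteH n) := by
  have h2 : (C (Real.sqrt 2) * C (Real.sqrt 2) : ℝ[X]) = 2 := by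
    rw [← C_mul, Real.mul_self_sqrt (by norm_num)]
    rfl
  simp only [hermiteH, hermite_succ, Polynomial.map_sub, Polynomial.map_mul, Polynomial.map_X,
    sub_comp, mul_comp, X_comp, derivative_mul, derivative_C, derivative_comp, derivative_map,
    derivative_X, C_mul, pow_succ]
  linear_combination (C (Real.sqrt 2 ^ n) * X *
    ((hermite n).map (Int.castRingHom ℝ)).comp (C (Real.sqrt 2) * X)) * h2

theorem natDegree_hermiteH (n : ℕ) : (hermiteH n).natDegree = n := by
  have h2 : Real.sqrt 2 ≠ 0 := by positivity
  rw [hermiteH, natDegree_C_mul (pow_ne_zero _ h2), natDegree_comp, natDegree_C_mul_X _ h2,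
    (hermite_monic n).natDegree_map, natDegree_hermite, mul_one]

theorem hermiteH_ne_zero (n : ℕ) : hermiteH n ≠ 0 := by
  rcases Nat.eq_zero_or_pos n with rfl | hn
  · simp [hermiteH_zero]
  · intro h
    have := natDegree_hermiteH n
    simp [h] at this
    omega

/-- Integration by parts: the recursion says that `H_(n+1) e^(-s²)` is minus the derivative of `H_n
e^(-s²)`. Iterating it `n` times annihilates every polynomial of degree below `n`. -/
theorem integral_hermiteH_succ_mul (n : ℕ) (p : ℝ[X]) :
    ∫ s : ℝ, (hermiteH (n + 1) * p).eval s * Real.exp (-s ^ 2) =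
      ∫ s : ℝ, (hermiteH n * derivative p).eval s * Real.exp (-s ^ 2) := by
  have h := integral_derivative_mul_exp_neg_sq (hermiteH n * p)
  have e : hermiteH (n + 1) * p =
      2 * X * (hermiteH n * p) - derivative (hermiteH n * p) + hermiteH n * derivative p := by
    rw [hermiteH_succ, derivative_mul]
    ring
  rw [e]
  simp_rw [eval_add (q := hermiteH n * derivative p), add_mul]
  rw [integral_add (integrable_eval_mul_exp_neg_sq _) (integrable_eval_mul_exp_neg_sq _)]
  simp_rw [eval_sub, sub_mul]
  rw [integral_sub (integrable_eval_mul_exp_neg_sq _) (integrable_eval_mul_exp_neg_sq _), h]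
  ring

theorem integral_hermiteH_mul_eq_zero (n : ℕ) (p : ℝ[X]) (hp : p.degree < n) :
    ∫ s : ℝ, (hermiteH n * p).eval s * Real.exp (-s ^ 2) = 0 := by
  induction n generalizing p with
  | zero =>
    have : p = 0 := by
      rw [← degree_eq_bot]
      simpa using hp
    simp [this]
  | succ n ih =>
    rw [integral_hermiteH_succ_mul]
    by_cases h0 : p = 0
    · simp [h0]
    refine ih _ ((degree_derivative_lt h0).trans_le ?_)
    rw [degree_eq_natDegree h0] at hp ⊢
    norm_cast at hp ⊢
    omega

/-! ### Sign changes and the number of real roots -/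

/-- Multiplying a real polynomial by suitable distinct linear factors, taken from its own roots,
makes its sign constant. -/
theorem exists_finset_roots_const_sign (n : ℕ) (p : ℝ[X]) (hn : p.natDegree = n) (hp : p ≠ 0) :
    ∃ Z ⊆ p.roots.toFinset,
      (∀ x, 0 ≤ (p * ∏ z ∈ Z, (X - C z)).eval x) ∨ (∀ x, (p * ∏ z ∈ Z, (X - C z)).eval x ≤ 0) := by
  induction n generalizing p with
  | zero =>
    refine ⟨∅, by simp, ?_⟩
    rw [eq_C_of_natDegree_eq_zero hn]
    rcases le_total 0 (p.coeff 0) with h | h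
    · left; simpa using h
    · right; simpa using h
  | succ n ih =>
    by_cases hr : ∃ a, p.IsRoot a
    · obtain ⟨a, ha⟩ := hr
      obtain ⟨q, rfl⟩ := dvd_iff_isRoot.mpr ha
      have hq : q ≠ 0 := right_ne_zero_of_mul hp
      have hdeg : q.natDegree = n := by
        rw [natDegree_mul (X_sub_C_ne_zero a) hq, natDegree_X_sub_C] at hn
        omega
      obtain ⟨Z, hZ, hs⟩ := ih q hdeg hq
      have hroots : ((X - C a) * q).roots.toFinset = insert a q.roots.toFinset := by
        rw [roots_mul hp, roots_X_sub_C]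
        simp
      by_cases haZ : a ∈ Z
      -- The new factor `X - a` of the polynomial replaces the one in the product; in the other case
      -- it is paired to a square.
      · refine ⟨Z.erase a, ?_, ?_⟩
        · rw [hroots]
          exact (Finset.erase_subset _ _).trans (hZ.trans (Finset.subset_insert _ _))
        · have : (X - C a) * q * ∏ z ∈ Z.erase a, (X - C z) = q * ∏ z ∈ Z, (X - C z) := by
            rw [← Finset.mul_prod_erase Z _ haZ]
            ring
          rwa [this]
      · refine ⟨insert a Z, ?_, ?_⟩
        · rw [hroots]
          exact Finset.insert_subset_insert _ hZ
        · have : ∀ x, ((X - C a) * q * ∏ z ∈ insert a Z, (X - C z)).eval x =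
              (x - a) ^ 2 * (q * ∏ z ∈ Z, (X - C z)).eval x := by
            intro x
            rw [Finset.prod_insert haZ]
            simp only [eval_mul, eval_sub, eval_X, eval_C]
            ring
          simp_rw [this]
          rcases hs with hs | hs
          · left; exact fun x => mul_nonneg (sq_nonneg _) (hs x)
          · right; exact fun x => mul_nonpos_of_nonneg_of_nonpos (sq_nonneg _) (hs x)
    · refine ⟨∅, by simp, ?_⟩
      simp only [Finset.prod_empty, mul_one]
      by_contra! h
      obtain ⟨⟨x, hx⟩, ⟨y, hy⟩⟩ := h
      obtain ⟨z, hz⟩ := mem_range_of_exists_le_of_exists_ge p.continuous ⟨x, hx.le⟩ ⟨y, hy.le⟩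
      exact hr ⟨z, hz⟩

theorem eq_zero_of_integral_eq_zero_of_nonneg (p : ℝ[X]) (hp : ∀ x, 0 ≤ p.eval x)
    (h : ∫ s : ℝ, p.eval s * Real.exp (-s ^ 2) = 0) : p = 0 := by
  have hc : Continuous fun s : ℝ => p.eval s * Real.exp (-s ^ 2) := by fun_prop
  rw [integral_eq_zero_iff_of_nonneg (fun s => mul_nonneg (hp s) (Real.exp_pos _).le)
    (integrable_eval_mul_exp_neg_sq p), hc.ae_eq_iff_eq volume continuous_zero] at h
  refine Polynomial.funext fun s => ?_
  have := congrFun h s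
  simpa [(Real.exp_pos _).ne'] using this

/-- With fewer than `M` distinct real roots, the sign-fixing product would have degree below `M`.
Its product with `H_M` would then have integral zero by orthogonality, although it is nonzero and of
constant sign. -/
theorem card_ghNodes (M : ℕ) : (ghNodes M).card = M := by
  refine le_antisymm ?_ ?_
  · exact (Multiset.toFinset_card_le _).trans ((card_roots' _).trans (natDegree_hermiteH M).le)
  · obtain ⟨Z, hZ, hs⟩ := exists_finset_roots_const_sign M _ (natDegree_hermiteH M)
      (hermiteH_ne_zero M)
    by_contra! hlt
    have hdeg : (∏ z ∈ Z, (X - C z)).degree < (M : WithBot ℕ) := by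
      rw [degree_prod]
      simp only [degree_X_sub_C, Finset.sum_const, nsmul_eq_mul, mul_one]
      exact_mod_cast (Finset.card_le_card hZ).trans_lt hlt
    have h0 := integral_hermiteH_mul_eq_zero M _ hdeg
    have hne : hermiteH M * ∏ z ∈ Z, (X - C z) ≠ 0 :=
      mul_ne_zero (hermiteH_ne_zero M) (Finset.prod_ne_zero_iff.mpr fun z _ => X_sub_C_ne_zero z)
    rcases hs with hs | hs
    · exact hne (eq_zero_of_integral_eq_zero_of_nonneg _ hs h0)
    · refine hne (neg_eq_zero.mp (eq_zero_of_integral_eq_zero_of_nonneg _ ?_ ?_))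
      · intro x
        simpa using hs x
      · simp only [eval_neg, neg_mul, integral_neg, h0, neg_zero]

/-! ### Gauss-Hermite quadrature -/

theorem eval_hermiteH_of_mem_ghNodes {M : ℕ} {v : ℝ} (hv : v ∈ ghNodes M) :
    (hermiteH M).eval v = 0 := by
  rw [ghNodes, Multiset.mem_toFinset] at hv
  exact isRoot_of_mem_roots hv

theorem sum_ghWeight_mul_eval_of_degree_lt (M : ℕ) (p : ℝ[X]) (hp : p.degree < M) :
    ∑ v ∈ ghNodes M, ghWeight M v * p.eval v = ∫ s : ℝ, p.eval s * Real.exp (-s ^ 2) := by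
  have hi := Lagrange.eq_interpolate (s := ghNodes M) (v := id) (f := p)
    (Set.injOn_id _) (by rwa [card_ghNodes])
  have : ∀ s : ℝ, p.eval s * Real.exp (-s ^ 2) =
      ∑ v ∈ ghNodes M, p.eval v * ((Lagrange.basis (ghNodes M) id v).eval s *
        Real.exp (-s ^ 2)) := by
    intro s
    conv_lhs => rw [hi, Lagrange.interpolate_apply, eval_finsetSum, Finset.sum_mul]
    simp [mul_assoc]
  simp_rw [this]
  rw [integral_finsetSum _ fun v _ => (integrable_eval_mul_exp_neg_sq _).const_mul _]
  refine Finset.sum_congr rfl fun v _ => ?_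
  rw [integral_const_mul, ghWeight, mul_comm]

/-- `M`-point Gauss-Hermite quadrature is exact in degrees below `2 M`. -/
theorem sum_ghWeight_mul_eval (M : ℕ) (p : ℝ[X]) (hp : p.natDegree < 2 * M) :
    ∑ v ∈ ghNodes M, ghWeight M v * p.eval v = ∫ s : ℝ, p.eval s * Real.exp (-s ^ 2) := by
  have hH := hermiteH_ne_zero M
  have hdH : (hermiteH M).degree = M := by
    rw [degree_eq_natDegree hH, natDegree_hermiteH]
  have hr : (p % hermiteH M).degree < M := hdH ▸ degree_mod_lt p hH
  have hq : (p / hermiteH M).degree < M := by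
    by_cases h0 : p / hermiteH M = 0
    · simp [h0]
    · have hp0 : p ≠ 0 := by
        rintro rfl
        simp at h0
      have hle : (hermiteH M).degree ≤ p.degree := by
        by_contra! hlt
        exact h0 ((Polynomial.div_eq_zero_iff hH).mpr hlt)
      have h := degree_add_div hH hle
      rw [hdH, degree_eq_natDegree h0, degree_eq_natDegree hp0] at h
      rw [degree_eq_natDegree h0]
      norm_cast at h ⊢
      omega
  -- The first summand vanishes at the nodes and has integral zero by orthogonality, so both sides
  -- see only the remainder.
  have hpq : p = hermiteH M * (p / hermiteH M) + p % hermiteH M :=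
    (EuclideanDomain.div_add_mod p _).symm
  have h1 : ∑ v ∈ ghNodes M, ghWeight M v * p.eval v =
      ∑ v ∈ ghNodes M, ghWeight M v * (p % hermiteH M).eval v := by
    refine Finset.sum_congr rfl fun v hv => ?_
    conv_lhs => rw [hpq, eval_add, eval_mul, eval_hermiteH_of_mem_ghNodes hv, zero_mul, zero_add]
  rw [h1, sum_ghWeight_mul_eval_of_degree_lt M _ hr]
  conv_rhs => rw [hpq]
  simp_rw [eval_add, add_mul]
  rw [integral_add (integrable_eval_mul_exp_neg_sq _) (integrable_eval_mul_exp_neg_sq _),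
    integral_hermiteH_mul_eq_zero M _ hq, zero_add]

theorem sum_ghWeight_mul_pow (M n : ℕ) (hn : n < 2 * M) :
    ∑ v ∈ ghNodes M, ghWeight M v * v ^ n = ∫ s : ℝ, s ^ n * Real.exp (-s ^ 2) := by
  simpa using sum_ghWeight_mul_eval M (X ^ n) (by simpa using hn)

/-- The square of the Lagrange basis polynomial has degree `2 M - 2`, so the quadrature is exact on
it and returns precisely the weight. -/
theorem ghWeight_nonneg {M : ℕ} {v : ℝ} (hv : v ∈ ghNodes M) : 0 ≤ ghWeight M v := by
  have hinj : Set.InjOn (id : ℝ → ℝ) (ghNodes M) := Set.injOn_id _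
  have hM : 0 < M := by
    rw [← card_ghNodes M]
    exact Finset.card_pos.mpr ⟨v, hv⟩
  have h := sum_ghWeight_mul_eval M (Lagrange.basis (ghNodes M) id v ^ 2) (by
    rw [natDegree_pow, Lagrange.natDegree_basis hinj hv, card_ghNodes]
    omega)
  rw [Finset.sum_eq_single v, eval_pow] at h
  · have h1 := Lagrange.eval_basis_self hinj hv
    simp only [id] at h1
    change ghWeight M v * (eval v (Lagrange.basis (ghNodes M) id v)) ^ 2 = _ at h
    rw [show eval v (Lagrange.basis (ghNodes M) id v) = 1 from h1, one_pow, mul_one] at h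
    rw [h]
    exact integral_nonneg fun s => mul_nonneg (by simpa using sq_nonneg _) (Real.exp_pos _).le
  · intro w hw hne
    have h1 : eval w (Lagrange.basis (ghNodes M) id v) = 0 :=
      Lagrange.eval_basis_of_ne (v := id) hne.symm hw
    simp [h1]
  · exact fun h => absurd hv h

theorem sum_ghWeight {M : ℕ} (hM : 1 ≤ M) :
    ∑ v ∈ ghNodes M, ghWeight M v = Real.sqrt Real.pi := by
  simpa [integral_exp_neg_sq] using sum_ghWeight_mul_pow M 0 (by omega)

theorem sum_ghWeight_mul_self {M : ℕ} (hM : 1 ≤ M) :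
    ∑ v ∈ ghNodes M, ghWeight M v * v = 0 := by
  have h := integral_derivative_mul_exp_neg_sq 1
  have e : ∀ s : ℝ, eval s (2 * X * 1 : ℝ[X]) * Real.exp (-s ^ 2) =
      2 * (s ^ 1 * Real.exp (-s ^ 2)) := by
    intro s
    simp [mul_assoc]
  simp_rw [e, integral_const_mul] at h
  have h' := sum_ghWeight_mul_pow M 1 (by omega)
  simp only [derivative_one, eval_zero, zero_mul, integral_zero, pow_one] at h h'
  linarith

theorem sum_ghWeight_mul_sq {M : ℕ} (hM : 2 ≤ M) :
    ∑ v ∈ ghNodes M, ghWeight M v * v ^ 2 = Real.sqrt Real.pi / 2 := by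
  rw [sum_ghWeight_mul_pow M 2 (by omega), integral_sq_mul_exp_neg_sq]

theorem sum_ghWeight_mul_pow_four_le {M : ℕ} (hM : 2 ≤ M) :
    ∑ v ∈ ghNodes M, ghWeight M v * v ^ 4 ≤ 3 / 4 * Real.sqrt Real.pi := by
  -- For `M = 2` exactness stops at degree 3, so the fourth moment is computed from the nodes, whose
  -- squares are `1 / 2`.
  rcases hM.eq_or_lt with rfl | hM3
  · have hv : ∀ v ∈ ghNodes 2, v ^ 2 = 1 / 2 := by
      intro v hv
      have h := eval_hermiteH_of_mem_ghNodes hv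
      rw [hermiteH_succ, hermiteH_succ, hermiteH_zero] at h
      simp at h
      linarith
    have : ∀ v ∈ ghNodes 2, ghWeight 2 v * v ^ 4 = 1 / 2 * (ghWeight 2 v * v ^ 2) := by
      intro v h
      rw [show v ^ 4 = v ^ 2 * v ^ 2 by ring, hv v h]
      ring
    rw [Finset.sum_congr rfl this, ← Finset.mul_sum, sum_ghWeight_mul_sq hM]
    nlinarith [Real.sqrt_nonneg Real.pi]
  · rw [sum_ghWeight_mul_pow M 4 (by omega), integral_pow_four_mul_exp_neg_sq]

theorem sum_ghWeight_mul_abs_pow_three_le {M : ℕ} (hM : 2 ≤ M) :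
    ∑ v ∈ ghNodes M, ghWeight M v * |v| ^ 3 ≤ 5 / 8 * Real.sqrt Real.pi := by
  calc ∑ v ∈ ghNodes M, ghWeight M v * |v| ^ 3
      ≤ ∑ v ∈ ghNodes M, (1 / 2 * (ghWeight M v * v ^ 2) + 1 / 2 * (ghWeight M v * v ^ 4)) := by
        refine Finset.sum_le_sum fun v hv => ?_
        have hw := ghWeight_nonneg hv
        have : |v| ^ 3 ≤ 1 / 2 * v ^ 2 + 1 / 2 * v ^ 4 := by
          rw [← sq_abs v, show v ^ 4 = |v| ^ 4 by rw [Even.pow_abs (by decide)]]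
          nlinarith [mul_nonneg (sq_nonneg |v|) (sq_nonneg (|v| - 1))]
        nlinarith [mul_le_mul_of_nonneg_left this hw]
    _ ≤ 5 / 8 * Real.sqrt Real.pi := by
        rw [Finset.sum_add_distrib, ← Finset.mul_sum, ← Finset.mul_sum, sum_ghWeight_mul_sq hM]
        linarith [sum_ghWeight_mul_pow_four_le hM]

theorem sum_ghWeight_mul_abs_le {M : ℕ} (hM : 2 ≤ M) :
    ∑ v ∈ ghNodes M, ghWeight M v * |v| ≤ 3 / 4 * Real.sqrt Real.pi := by
  calc ∑ v ∈ ghNodes M, ghWeight M v * |v|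
      ≤ ∑ v ∈ ghNodes M, (1 / 2 * ghWeight M v + 1 / 2 * (ghWeight M v * v ^ 2)) := by
        refine Finset.sum_le_sum fun v hv => ?_
        have hw := ghWeight_nonneg hv
        have : |v| ≤ 1 / 2 + 1 / 2 * v ^ 2 := by
          rw [← sq_abs v]
          nlinarith [sq_nonneg (|v| - 1)]
        nlinarith [mul_le_mul_of_nonneg_left this hw]
    _ = 3 / 4 * Real.sqrt Real.pi := by
        rw [Finset.sum_add_distrib, ← Finset.mul_sum, ← Finset.mul_sum, sum_ghWeight_mul_sq hM,
          sum_ghWeight (by omega)]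
        ring

/-! ### Gauss-Hermite quadrature of oscillating exponentials -/

/-- Along `t ↦ t θ`, the derivative of the remainder of order `n + 1` is `i θ` times the remainder
of order `n`; comparing derivatives on `[0, 1]` gives the induction step. -/
theorem norm_exp_mul_I_sub_sum_le (n : ℕ) (θ : ℝ) :
    ‖Complex.exp (θ * Complex.I) - ∑ k ∈ Finset.range n, (θ * Complex.I) ^ k / k.factorial‖
      ≤ |θ| ^ n / n.factorial := by
  induction n generalizing θ with
  | zero => simp [Complex.norm_exp_ofReal_mul_I]
  | succ n ih =>
    have hd : ∀ t : ℝ, HasDerivAt (fun t : ℝ => Complex.exp ((t * θ : ℝ) * Complex.I) -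
        ∑ k ∈ Finset.range (n + 1), ((t * θ : ℝ) * Complex.I) ^ k / k.factorial)
        ((Complex.exp ((t * θ : ℝ) * Complex.I) -
          ∑ k ∈ Finset.range n, ((t * θ : ℝ) * Complex.I) ^ k / k.factorial)
            * (θ * Complex.I)) t := by
      intro t
      have h0 : HasDerivAt (fun t : ℝ => ((t * θ : ℝ) : ℂ) * Complex.I) (θ * Complex.I) t := by
        have := ((hasDerivAt_mul_const (x := t) θ).ofReal_comp).mul_const Complex.I
        simpa using this
      have h1 := h0.cexp
      have h2 : HasDerivAt (fun t : ℝ =>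
          ∑ k ∈ Finset.range (n + 1), ((t * θ : ℝ) * Complex.I) ^ k / (k.factorial : ℂ))
          (∑ k ∈ Finset.range (n + 1), (k * ((t * θ : ℝ) * Complex.I) ^ (k - 1) *
            (θ * Complex.I)) / (k.factorial : ℂ)) t :=
        HasDerivAt.fun_sum fun k _ => (h0.pow k).div_const _
      refine (h1.sub h2).congr_deriv ?_
      rw [Finset.sum_range_succ', sub_mul, Finset.sum_mul]
      congr 1
      simp only [Nat.cast_zero, zero_mul, zero_div, add_zero, Nat.add_sub_cancel]
      refine Finset.sum_congr rfl fun k _ => ?_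
      have hk : ((k + 1 : ℕ) : ℂ) ≠ 0 := Nat.cast_ne_zero.mpr k.succ_ne_zero
      have hk' : (k.factorial : ℂ) ≠ 0 := Nat.cast_ne_zero.mpr k.factorial_ne_zero
      rw [Nat.factorial_succ, Nat.cast_mul]
      field_simp
    have hB : ∀ t : ℝ, HasDerivAt (fun t : ℝ => (t * |θ|) ^ (n + 1) / (n + 1).factorial)
        ((t * |θ|) ^ n / n.factorial * |θ|) t := by
      intro t
      refine (((hasDerivAt_mul_const (x := t) |θ|).pow (n + 1)).div_const _).congr_deriv ?_
      have hk : ((n + 1 : ℕ) : ℝ) ≠ 0 := Nat.cast_ne_zero.mpr n.succ_ne_zero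
      have hk' : (n.factorial : ℝ) ≠ 0 := Nat.cast_ne_zero.mpr n.factorial_ne_zero
      rw [Nat.factorial_succ, Nat.cast_mul, Nat.add_sub_cancel]
      field_simp
    have := image_norm_le_of_norm_deriv_right_le_deriv_boundary (a := 0) (b := 1)
      (fun t _ => (hd t).continuousAt.continuousWithinAt) (fun t _ => (hd t).hasDerivWithinAt)
      (by simp [Finset.sum_range_succ']) hB (fun t ht => by
        rw [norm_mul]
        have h := ih (t * θ)
        rw [abs_mul, abs_of_nonneg ht.1] at h
        have h' : ‖(θ * Complex.I : ℂ)‖ = |θ| := by simp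
        rw [h']
        exact mul_le_mul_of_nonneg_right h (abs_nonneg _)) (Set.right_mem_Icc.mpr zero_le_one)
    simpa using this

/-- The Gauss-Hermite quadrature of `v ↦ v * exp (i θ v)`. -/
noncomputable def ghCharSum (M : ℕ) (θ : ℝ) : ℂ :=
  ∑ v ∈ ghNodes M, ((ghWeight M v * v : ℝ) : ℂ) * Complex.exp ((θ * v : ℝ) * Complex.I)

theorem norm_ghCharSum_le {M : ℕ} (hM : 2 ≤ M) (θ : ℝ) :
    ‖ghCharSum M θ‖ ≤ 3 / 4 * Real.sqrt Real.pi := by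
  refine (norm_sum_le _ _).trans (le_trans (Finset.sum_le_sum fun v hv => ?_)
    (sum_ghWeight_mul_abs_le hM))
  rw [norm_mul, Complex.norm_exp_ofReal_mul_I, mul_one, Complex.norm_real, Real.norm_eq_abs,
    abs_mul, abs_of_nonneg (ghWeight_nonneg hv)]

theorem integrable_ofReal_pow_mul_exp_neg_sq' (n : ℕ) :
    Integrable fun s : ℝ => ((s ^ n * Real.exp (-s ^ 2) : ℝ) : ℂ) :=
  (integrable_pow_mul_exp_neg_sq n).ofReal

theorem integrable_ofReal_pow_mul_exp_neg_sq (n : ℕ) :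
    Integrable fun s : ℝ => (s : ℂ) ^ n * (Real.exp (-s ^ 2) : ℂ) := by
  simpa using integrable_ofReal_pow_mul_exp_neg_sq' n

theorem integrable_pow_mul_cexp_mul_exp_neg_sq (n : ℕ) (θ : ℝ) :
    Integrable fun s : ℝ => (s : ℂ) ^ n * (Real.exp (-s ^ 2) : ℂ) *
      Complex.exp ((θ * s : ℝ) * Complex.I) := by
  refine (integrable_ofReal_pow_mul_exp_neg_sq n).mul_bdd (c := 1)
    (Continuous.aestronglyMeasurable (by fun_prop)) (Filter.Eventually.of_forall fun s => ?_)
  rw [Complex.norm_exp_ofReal_mul_I]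

theorem integral_mul_cexp_mul_exp_neg_sq (θ : ℝ) :
    ∫ s : ℝ, (s : ℂ) ^ 1 * (Real.exp (-s ^ 2) : ℂ) * Complex.exp ((θ * s : ℝ) * Complex.I) =
      θ * Complex.I / 2 * ((Real.sqrt Real.pi * Real.exp (-θ ^ 2 / 4) : ℝ) : ℂ) := by
  have hd : ∀ s : ℝ, HasDerivAt
      (fun s : ℝ => (s : ℂ) ^ 0 * (Real.exp (-s ^ 2) : ℂ) * Complex.exp ((θ * s : ℝ) * Complex.I))
      ((θ * Complex.I) * ((s : ℂ) ^ 0 * (Real.exp (-s ^ 2) : ℂ) *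
          Complex.exp ((θ * s : ℝ) * Complex.I)) -
        2 * ((s : ℂ) ^ 1 * (Real.exp (-s ^ 2) : ℂ) *
          Complex.exp ((θ * s : ℝ) * Complex.I))) s := by
    intro s
    have h1 : HasDerivAt (fun s : ℝ => (Real.exp (-s ^ 2) : ℂ))
        ((Real.exp (-s ^ 2) * -(2 * s) : ℝ) : ℂ) s := by
      have : HasDerivAt (fun s : ℝ => Real.exp (-s ^ 2)) (Real.exp (-s ^ 2) * -(2 * s)) s := by
        simpa using ((hasDerivAt_pow 2 s).neg).exp
      exact this.ofReal_comp
    have h2 : HasDerivAt (fun s : ℝ => ((θ * s : ℝ) : ℂ) * Complex.I) (θ * Complex.I) s := by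
      have := ((hasDerivAt_const_mul (x := s) θ).ofReal_comp).mul_const Complex.I
      simpa using this
    simp only [pow_zero, one_mul, pow_one]
    refine (h1.mul h2.cexp).congr_deriv ?_
    push_cast
    ring
  have h := integral_eq_zero_of_hasDerivAt_of_integrable hd
    (((integrable_pow_mul_cexp_mul_exp_neg_sq 0 θ).const_mul _).sub
      ((integrable_pow_mul_cexp_mul_exp_neg_sq 1 θ).const_mul _))
    (integrable_pow_mul_cexp_mul_exp_neg_sq 0 θ)
  rw [integral_sub ((integrable_pow_mul_cexp_mul_exp_neg_sq 0 θ).const_mul _)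
      ((integrable_pow_mul_cexp_mul_exp_neg_sq 1 θ).const_mul _),
    integral_const_mul, integral_const_mul] at h
  have hF : ∫ s : ℝ, (s : ℂ) ^ 0 * (Real.exp (-s ^ 2) : ℂ) *
      Complex.exp ((θ * s : ℝ) * Complex.I) =
      ((Real.sqrt Real.pi * Real.exp (-θ ^ 2 / 4) : ℝ) : ℂ) := by
    have h := fourierIntegral_gaussian (b := 1) (by simp) (θ : ℂ)
    have e : ∀ s : ℝ, (s : ℂ) ^ 0 * (Real.exp (-s ^ 2) : ℂ) *
        Complex.exp ((θ * s : ℝ) * Complex.I) =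
        Complex.exp (Complex.I * θ * s) * Complex.exp (-1 * s ^ 2) := by
      intro s
      push_cast
      rw [mul_comm, pow_zero, one_mul]
      congr 2 <;> ring
    simp_rw [e]
    rw [h, Real.sqrt_eq_rpow]
    push_cast
    rw [Complex.ofReal_cpow Real.pi_pos.le]
    simp
  rw [hF] at h
  linear_combination (-1 / 2) * h

/-- The quadrature is exact on `v` times the Taylor polynomial of the exponential. The two Taylor
remainders, under the sum and under the integral, are both controlled by the moment of order `2 m +
2`, still in the exact range for `m + 2` nodes. -/
theorem norm_ghCharSum_sub_integral_le (m : ℕ) (θ : ℝ) :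
    ‖ghCharSum (m + 2) θ -
      ∫ s : ℝ, (s : ℂ) ^ 1 * (Real.exp (-s ^ 2) : ℂ) * Complex.exp ((θ * s : ℝ) * Complex.I)‖
      ≤ 2 * Real.sqrt Real.pi * (|θ| ^ (2 * m + 1) / m.factorial) := by
  set n := 2 * m + 1 with hn
  let T : ℝ → ℂ := fun s =>
    ∑ k ∈ Finset.range n, (((θ * s : ℝ) : ℂ) * Complex.I) ^ k / k.factorial
  have hT : ∀ s : ℝ, ‖Complex.exp ((θ * s : ℝ) * Complex.I) - T s‖
      ≤ |θ| ^ n / n.factorial * |s| ^ n := by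
    intro s
    refine (norm_exp_mul_I_sub_sum_le n (θ * s)).trans_eq ?_
    rw [abs_mul, mul_pow]
    ring
  have hTs : ∀ s : ℝ, (s : ℂ) * T s =
      ∑ k ∈ Finset.range n, ((θ * Complex.I) ^ k / k.factorial) * ((s ^ (k + 1) : ℝ) : ℂ) := by
    intro s
    simp only [T, Finset.mul_sum]
    refine Finset.sum_congr rfl fun k _ => ?_
    push_cast
    ring
  have hI : ∀ s : ℝ, (s : ℂ) ^ 1 * (Real.exp (-s ^ 2) : ℂ) * T s =
      ∑ k ∈ Finset.range n, ((θ * Complex.I) ^ k / k.factorial) *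
        ((s ^ (k + 1) * Real.exp (-s ^ 2) : ℝ) : ℂ) := by
    intro s
    have : (s : ℂ) ^ 1 * (Real.exp (-s ^ 2) : ℂ) * T s = (Real.exp (-s ^ 2) : ℂ) * (s * T s) := by
      ring
    rw [this, hTs, Finset.mul_sum]
    refine Finset.sum_congr rfl fun k _ => ?_
    push_cast
    ring
  have hIint : Integrable fun s : ℝ => (s : ℂ) ^ 1 * (Real.exp (-s ^ 2) : ℂ) * T s := by
    simp_rw [hI]
    exact integrable_finsetSum _ fun k _ =>
      (integrable_ofReal_pow_mul_exp_neg_sq' (k + 1)).const_mul _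
  have hexact : ∑ v ∈ ghNodes (m + 2), ((ghWeight (m + 2) v * v : ℝ) : ℂ) * T v =
      ∫ s : ℝ, (s : ℂ) ^ 1 * (Real.exp (-s ^ 2) : ℂ) * T s := by
    simp_rw [hI]
    rw [integral_finsetSum _ fun k _ =>
      (integrable_ofReal_pow_mul_exp_neg_sq' (k + 1)).const_mul _]
    have : ∀ v ∈ ghNodes (m + 2), ((ghWeight (m + 2) v * v : ℝ) : ℂ) * T v =
        ∑ k ∈ Finset.range n, ((θ * Complex.I) ^ k / k.factorial) *
          ((ghWeight (m + 2) v * v ^ (k + 1) : ℝ) : ℂ) := by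
      intro v _
      have : ((ghWeight (m + 2) v * v : ℝ) : ℂ) * T v =
          (ghWeight (m + 2) v : ℂ) * ((v : ℂ) * T v) := by
        push_cast
        ring
      rw [this, hTs, Finset.mul_sum]
      refine Finset.sum_congr rfl fun k _ => ?_
      push_cast
      ring
    rw [Finset.sum_congr rfl this, Finset.sum_comm]
    refine Finset.sum_congr rfl fun k hk => ?_
    rw [← Finset.mul_sum, integral_const_mul, integral_complex_ofReal, ← Complex.ofReal_sum,
      sum_ghWeight_mul_pow]
    have := Finset.mem_range.mp hk
    omega
  have hmom : ∀ s : ℝ, |s| * |s| ^ n = s ^ (2 * (m + 1)) := by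
    intro s
    rw [← pow_succ', pow_mul, ← sq_abs s, ← pow_mul]
    congr 1
  have hQ : ‖ghCharSum (m + 2) θ -
      ∑ v ∈ ghNodes (m + 2), ((ghWeight (m + 2) v * v : ℝ) : ℂ) * T v‖
      ≤ |θ| ^ n / n.factorial * (Real.sqrt Real.pi * (m + 1).factorial) := by
    rw [ghCharSum, ← Finset.sum_sub_distrib]
    calc _ ≤ ∑ v ∈ ghNodes (m + 2), |θ| ^ n / n.factorial *
          (ghWeight (m + 2) v * v ^ (2 * (m + 1))) := by
          refine (norm_sum_le _ _).trans (Finset.sum_le_sum fun v hv => ?_)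
          have hw := ghWeight_nonneg hv
          rw [← mul_sub, norm_mul, Complex.norm_real, Real.norm_eq_abs, abs_mul,
            abs_of_nonneg hw, ← hmom]
          refine (mul_le_mul_of_nonneg_left (hT v) (by positivity)).trans_eq ?_
          ring
      _ ≤ _ := by
          rw [← Finset.mul_sum, sum_ghWeight_mul_pow _ _ (by omega)]
          exact mul_le_mul_of_nonneg_left (integral_even_pow_mul_exp_neg_sq_le (m + 1))
            (by positivity)
  have hG : ‖(∫ s : ℝ, (s : ℂ) ^ 1 * (Real.exp (-s ^ 2) : ℂ) * T s) -
      ∫ s : ℝ, (s : ℂ) ^ 1 * (Real.exp (-s ^ 2) : ℂ) * Complex.exp ((θ * s : ℝ) * Complex.I)‖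
      ≤ |θ| ^ n / n.factorial * (Real.sqrt Real.pi * (m + 1).factorial) := by
    rw [← integral_sub hIint (integrable_pow_mul_cexp_mul_exp_neg_sq 1 θ)]
    calc _ ≤ ∫ s : ℝ, |θ| ^ n / n.factorial * (s ^ (2 * (m + 1)) * Real.exp (-s ^ 2)) := by
          refine norm_integral_le_of_norm_le
            ((integrable_pow_mul_exp_neg_sq (2 * (m + 1))).const_mul _)
            (Filter.Eventually.of_forall fun s => ?_)
          rw [← mul_sub, norm_mul, norm_mul, pow_one, Complex.norm_real, Complex.norm_real,
            Real.norm_eq_abs, Real.norm_eq_abs, abs_of_pos (Real.exp_pos _), ← hmom, norm_sub_rev]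
          refine (mul_le_mul_of_nonneg_left (hT s) (by positivity)).trans_eq ?_
          ring
      _ ≤ _ := by
          rw [integral_const_mul]
          exact mul_le_mul_of_nonneg_left (integral_even_pow_mul_exp_neg_sq_le (m + 1))
            (by positivity)
  have hfac : |θ| ^ n / n.factorial * (Real.sqrt Real.pi * (m + 1).factorial) ≤
      Real.sqrt Real.pi * (|θ| ^ n / m.factorial) := by
    have h1 : ((m + 1).factorial : ℝ) * m.factorial ≤ n.factorial := by
      have := Nat.factorial_mul_factorial_dvd_factorial_add (m + 1) m
      rw [show m + 1 + m = n by omega] at this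
      exact_mod_cast Nat.le_of_dvd (Nat.factorial_pos _) this
    have h2 : (0 : ℝ) < m.factorial := by positivity
    have h3 : (0 : ℝ) < n.factorial := by positivity
    rw [div_mul_eq_mul_div, mul_div_assoc', div_le_div_iff₀ h3 h2]
    have h4 : 0 ≤ |θ| ^ n * Real.sqrt Real.pi := by positivity
    nlinarith [mul_le_mul_of_nonneg_left h1 h4]
  rw [hexact] at hQ
  calc _ ≤ _ := norm_sub_le_norm_sub_add_norm_sub _
        (∫ s : ℝ, (s : ℂ) ^ 1 * (Real.exp (-s ^ 2) : ℂ) * T s) _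
    _ ≤ _ := by linarith

/-- A bound on the error of the `m + 2`-point quadrature at frequency `θ ≥ 0`. -/
noncomputable def ghCharErr (m : ℕ) (θ : ℝ) : ℝ :=
  2 * Real.sqrt Real.pi * min 1 (θ ^ (2 * m + 1) / m.factorial)

/-- The minimum in `ghCharErr` combines the Taylor bound, small for large `m` at fixed frequency,
with the trivial bound, uniform in the frequency. The latter is what dominated convergence needs. -/
theorem norm_ghCharSum_le_add (m : ℕ) (θ : ℝ) :
    ‖ghCharSum (m + 2) θ‖ ≤
      Real.sqrt Real.pi / 2 * (|θ| * Real.exp (-θ ^ 2 / 4)) + ghCharErr m |θ| := by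
  have hpi := Real.sqrt_nonneg Real.pi
  rcases le_total 1 (|θ| ^ (2 * m + 1) / m.factorial) with h | h
  · rw [ghCharErr, min_eq_left h]
    have h1 := norm_ghCharSum_le (M := m + 2) (by omega) θ
    have h2 : 0 ≤ Real.sqrt Real.pi / 2 * (|θ| * Real.exp (-θ ^ 2 / 4)) := by positivity
    linarith
  · rw [ghCharErr, min_eq_right h]
    have h1 := norm_ghCharSum_sub_integral_le m θ
    rw [integral_mul_cexp_mul_exp_neg_sq] at h1
    have h2 : ‖(θ * Complex.I / 2 * ((Real.sqrt Real.pi * Real.exp (-θ ^ 2 / 4) : ℝ) : ℂ) : ℂ)‖ =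
        Real.sqrt Real.pi / 2 * (|θ| * Real.exp (-θ ^ 2 / 4)) := by
      rw [norm_mul, norm_div, norm_mul, Complex.norm_real, Complex.norm_real, Complex.norm_I,
        Real.norm_eq_abs, Real.norm_eq_abs, abs_of_nonneg (by positivity :
          0 ≤ Real.sqrt Real.pi * Real.exp (-θ ^ 2 / 4))]
      simp
      ring
    rw [← h2]
    exact norm_le_norm_add_norm_sub' _ _ |>.trans (by gcongr)

/-! ### Mollification of a bandlimited signal -/

theorem continuous_fourier_of_integrable {f : ℝ → ℂ} (hf : Integrable f) : Continuous (𝓕 f) :=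
  VectorFourier.fourierIntegral_continuous Real.continuous_fourierChar
    (by fun_prop) hf

open scoped Convolution in
/-- A smooth mollifier of radius `δ`, described through its Fourier transform `k`. -/
theorem exists_mollifier_fourier {δ : ℝ} (hδ : 0 < δ) :
    ∃ k : ℝ → ℂ, Integrable k ∧ (∀ u, ‖k u‖ ≤ 1) ∧
      ∀ (η : ℝ → ℝ) (γ s : ℝ), Continuous η → Integrable η →
        (∀ u, ‖𝓕 (fun y : ℝ => (η y : ℂ)) u‖ ≤ γ) →
        (∀ y y', |y - y'| < δ → |η y - η y'| ≤ s) →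
        Integrable (fun u => k u * 𝓕 (fun y : ℝ => (η y : ℂ)) u) ∧
        ∀ y : ℝ, ‖(η y : ℂ) - ∫ u : ℝ, Complex.exp ((2 * Real.pi * u * y : ℝ) * Complex.I) *
          (k u * 𝓕 (fun y : ℝ => (η y : ℂ)) u)‖ ≤ s := by
  -- The normalized bump is Schwartz, so its transform `k` is integrable, and it has mass one,
  -- whence `‖k‖ ≤ 1`. Inversion then holds for its convolution with `η`, whose transform is `k`
  -- times a bounded function.
  let ρ : ContDiffBump (0 : ℝ) := ⟨δ / 2, δ, by positivity, by linarith⟩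
  let f : ℝ → ℂ := fun y => (ρ.normed volume y : ℂ)
  have hfs : ContDiff ℝ (⊤ : ℕ∞) f := Complex.ofRealCLM.contDiff.comp ρ.contDiff_normed
  have hfc : HasCompactSupport f := (ρ.hasCompactSupport_normed (μ := volume)).comp_left
    (g := fun y : ℝ => (y : ℂ)) Complex.ofReal_zero
  let F : SchwartzMap ℝ ℂ := hfc.toSchwartzMap hfs
  have hFf : (F : ℝ → ℂ) = f := rfl
  have hfint : Integrable f := F.integrable
  refine ⟨𝓕 f, ?_, ?_, ?_⟩
  · have := (𝓕 F).integrable (μ := volume)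
    rwa [SchwartzMap.fourier_coe, hFf] at this
  · intro u
    refine (VectorFourier.norm_fourierIntegral_le_integral_norm _ _ _ _ _).trans_eq ?_
    rw [← ρ.integral_normed (μ := volume)]
    refine integral_congr_ae (Filter.Eventually.of_forall fun y => ?_)
    simp [f, abs_of_nonneg (ρ.nonneg_normed y)]
  · intro η γ s hη hηi hb hmod
    have hηc : Continuous fun y : ℝ => (η y : ℂ) := by fun_prop
    have hηci : Integrable fun y : ℝ => (η y : ℂ) := hηi.ofReal
    have hk : Integrable (fun u => 𝓕 f u * 𝓕 (fun y : ℝ => (η y : ℂ)) u) := by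
      have h1 := (𝓕 F).integrable (μ := volume)
      rw [SchwartzMap.fourier_coe, hFf] at h1
      exact h1.mul_bdd (continuous_fourier_of_integrable hηci).aestronglyMeasurable
        (Filter.Eventually.of_forall hb)
    refine ⟨hk, fun y => ?_⟩
    let h : ℝ → ℂ := f ⋆[ContinuousLinearMap.mul ℂ ℂ, volume] (fun y : ℝ => (η y : ℂ))
    have hheq : h = (ρ.normed volume ⋆[ContinuousLinearMap.lsmul ℝ ℝ, volume]
        (fun y : ℝ => (η y : ℂ)) : ℝ → ℂ) := by
      funext x
      simp only [h, convolution, ContinuousLinearMap.mul_apply', ContinuousLinearMap.lsmul_apply,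
        f, Complex.real_smul]
    have hhc : Continuous h := by
      rw [hheq]
      exact (ρ.hasCompactSupport_normed (μ := volume)).continuous_convolution_left _
        ρ.continuous_normed hηc.locallyIntegrable
    have hhi : Integrable h := hfint.integrable_convolution _ hηci
    have hF : 𝓕 h = fun u => 𝓕 f u * 𝓕 (fun y : ℝ => (η y : ℂ)) u :=
      funext fun u => Real.fourier_mul_convolution_eq hfint hηci u
    have hinv := congrFun (hhc.fourierInv_fourier_eq hhi (by rwa [hF])) y
    rw [Real.fourierInv_eq', hF] at hinv
    have hval : ∫ u : ℝ, Complex.exp ((2 * Real.pi * u * y : ℝ) * Complex.I) *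
        (𝓕 f u * 𝓕 (fun y : ℝ => (η y : ℂ)) u) = h y := by
      rw [← hinv]
      refine integral_congr_ae (Filter.Eventually.of_forall fun u => ?_)
      simp only [smul_eq_mul, RCLike.inner_apply, conj_trivial]
      congr 4
      ring
    rw [hval, hheq, ← dist_eq_norm, dist_comm]
    refine ρ.dist_normed_convolution_le hηc.aestronglyMeasurable fun x hx => ?_
    rw [dist_eq_norm, ← Complex.ofReal_sub, Complex.norm_real]
    exact hmod x y (by simpa [Real.dist_eq] using hx)

/-! ### Gauss-Hermite differentiation of a bandlimited signal -/

theorem integral_Ioi_mul_exp_neg_mul_sq {c : ℝ} (hc : 0 < c) (a : ℝ) :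
    ∫ u in Set.Ioi a, u * Real.exp (-c * u ^ 2) = Real.exp (-c * a ^ 2) / (2 * c) := by
  have hd : ∀ u : ℝ, HasDerivAt (fun u : ℝ => -(Real.exp (-c * u ^ 2) / (2 * c)))
      (u * Real.exp (-c * u ^ 2)) u := by
    intro u
    have := ((((hasDerivAt_pow 2 u).const_mul (-c)).exp).div_const (2 * c)).neg
    refine this.congr_deriv ?_
    field_simp
    simp [mul_comm]
  have hlim : Filter.Tendsto (fun u : ℝ => -(Real.exp (-c * u ^ 2) / (2 * c))) Filter.atTop
      (nhds 0) := by
    have h1 : Filter.Tendsto (fun u : ℝ => -c * u ^ 2) Filter.atTop Filter.atBot :=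
      (Filter.tendsto_pow_atTop two_ne_zero).const_mul_atTop_of_neg (by linarith)
    simpa using ((Real.tendsto_exp_atBot.comp h1).div_const (2 * c)).neg
  rw [integral_Ioi_of_hasDerivAt_of_tendsto' (fun u _ => hd u)
    (integrable_mul_exp_neg_mul_sq hc).integrableOn hlim]
  ring

theorem integral_indicator_abs_mul_exp_neg_mul_sq {c a : ℝ} (hc : 0 < c) (ha : 0 < a) :
    ∫ u : ℝ, {u : ℝ | a ≤ |u|}.indicator (fun u => |u| * Real.exp (-c * u ^ 2)) u =
      Real.exp (-c * a ^ 2) / c := by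
  have h := integral_comp_abs (f := (Set.Ici a).indicator (fun u => u * Real.exp (-c * u ^ 2)))
  have e : ∀ u : ℝ, {u : ℝ | a ≤ |u|}.indicator (fun u => |u| * Real.exp (-c * u ^ 2)) u =
      (Set.Ici a).indicator (fun u => u * Real.exp (-c * u ^ 2)) |u| := by
    intro u
    simp [Set.indicator_apply]
  simp_rw [e]
  rw [h, setIntegral_indicator measurableSet_Ici,
    Set.inter_eq_right.mpr (Set.Ici_subset_Ioi.mpr ha), integral_Ici_eq_integral_Ioi,
    integral_Ioi_mul_exp_neg_mul_sq hc]
  field_simp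

theorem integrable_abs_mul_exp_neg_mul_sq {c : ℝ} (hc : 0 < c) :
    Integrable fun u : ℝ => |u| * Real.exp (-c * u ^ 2) := by
  simpa [abs_mul] using (integrable_mul_exp_neg_mul_sq hc).norm

theorem ghDeriv_eq (M : ℕ) (σ : ℝ) (G : ℝ → ℝ) :
    ghDeriv M σ G = Real.sqrt 2 / (Real.sqrt Real.pi * σ) *
      ∑ v ∈ ghNodes M, ghWeight M v * v * G (Real.sqrt 2 * σ * v) := by
  rw [ghDeriv, Finset.mul_sum, Finset.mul_sum]
  refine Finset.sum_congr rfl fun v _ => ?_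
  ring

theorem ghCharErr_nonneg (m : ℕ) {θ : ℝ} (hθ : 0 ≤ θ) : 0 ≤ ghCharErr m θ := by
  unfold ghCharErr
  positivity

theorem ghCharErr_le (m : ℕ) (θ : ℝ) : ghCharErr m θ ≤ 2 * Real.sqrt Real.pi := by
  unfold ghCharErr
  nlinarith [min_le_left 1 (θ ^ (2 * m + 1) / (m.factorial : ℝ)), Real.sqrt_nonneg Real.pi]

theorem ghCharErr_mono (m : ℕ) {θ θ' : ℝ} (hθ : 0 ≤ θ) (h : θ ≤ θ') :
    ghCharErr m θ ≤ ghCharErr m θ' := by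
  unfold ghCharErr
  gcongr

theorem continuous_ghCharErr (m : ℕ) : Continuous (ghCharErr m) := by
  unfold ghCharErr
  fun_prop

theorem tendsto_ghCharErr (θ : ℝ) :
    Filter.Tendsto (fun m => ghCharErr m θ) Filter.atTop (nhds 0) := by
  have h1 : Filter.Tendsto (fun m : ℕ => θ ^ (2 * m + 1) / (m.factorial : ℝ)) Filter.atTop
      (nhds 0) := by
    have := (FloorSemiring.tendsto_pow_div_factorial_atTop (θ ^ 2)).const_mul θ
    rw [mul_zero] at this
    refine this.congr fun m => ?_
    rw [← pow_mul, pow_succ]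
    ring
  have h2 := (tendsto_const_nhds (x := (1 : ℝ))).min h1
  rw [min_eq_right zero_le_one] at h2
  simpa [ghCharErr] using h2.const_mul (2 * Real.sqrt Real.pi)

theorem integrable_norm_mul_ghCharErr {k : ℝ → ℂ} (hk : Integrable k) (m : ℕ) {c : ℝ}
    (hc : 0 ≤ c) : Integrable fun u => ‖k u‖ * ghCharErr m (c * |u|) := by
  have hcont : Continuous fun u : ℝ => ghCharErr m (c * |u|) :=
    (continuous_ghCharErr m).comp (by fun_prop)
  refine hk.norm.mul_bdd (c := 2 * Real.sqrt Real.pi)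
    hcont.aestronglyMeasurable (Filter.Eventually.of_forall fun u => ?_)
  rw [Real.norm_eq_abs, abs_of_nonneg (ghCharErr_nonneg m (by positivity))]
  exact ghCharErr_le m _

theorem tendsto_integral_norm_mul_ghCharErr {k : ℝ → ℂ} (hk : Integrable k) {c : ℝ} (hc : 0 ≤ c) :
    Filter.Tendsto (fun m => ∫ u, ‖k u‖ * ghCharErr m (c * |u|)) Filter.atTop (nhds 0) := by
  have := tendsto_integral_of_dominated_convergence (F := fun m u => ‖k u‖ * ghCharErr m (c * |u|))
    (f := fun _ => 0) (fun u => ‖k u‖ * (2 * Real.sqrt Real.pi))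
    (fun m => (integrable_norm_mul_ghCharErr hk m hc).aestronglyMeasurable)
    (hk.norm.mul_const _)
    (fun m => Filter.Eventually.of_forall fun u => by
      have h := ghCharErr_nonneg m (θ := c * |u|) (by positivity)
      rw [Real.norm_eq_abs, abs_of_nonneg (by positivity)]
      exact mul_le_mul_of_nonneg_left (ghCharErr_le m _) (norm_nonneg _))
    (Filter.Eventually.of_forall fun u => by
      simpa using (tendsto_ghCharErr (c * |u|)).const_mul ‖k u‖)
  simpa using this

theorem abs_ghDeriv_le_of_abs_le {M : ℕ} (hM : 2 ≤ M) {σ : ℝ} (hσ : 0 < σ) {G : ℝ → ℝ} {K : ℝ}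
    (hG : ∀ y, |G y| ≤ K) : |ghDeriv M σ G| ≤ 2 * K / σ := by
  have hK : 0 ≤ K := (abs_nonneg _).trans (hG 0)
  have hpi : 0 < Real.sqrt Real.pi := Real.sqrt_pos.mpr Real.pi_pos
  have hsum : |∑ v ∈ ghNodes M, ghWeight M v * v * G (Real.sqrt 2 * σ * v)| ≤
      3 / 4 * Real.sqrt Real.pi * K := by
    refine (Finset.abs_sum_le_sum_abs _ _).trans ?_
    refine le_trans (Finset.sum_le_sum fun v hv => ?_)
      ((Finset.sum_mul _ _ K).ge.trans
        (mul_le_mul_of_nonneg_right (sum_ghWeight_mul_abs_le hM) hK))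
    rw [abs_mul, abs_mul, abs_of_nonneg (ghWeight_nonneg hv)]
    exact mul_le_mul_of_nonneg_left (hG _) (mul_nonneg (ghWeight_nonneg hv) (abs_nonneg _))
  rw [ghDeriv_eq, abs_mul, abs_of_nonneg (by positivity)]
  refine (mul_le_mul_of_nonneg_left hsum (by positivity)).trans ?_
  have h2 : Real.sqrt 2 ≤ 2 := by
    rw [Real.sqrt_le_left (by norm_num)]
    norm_num
  rw [div_mul_eq_mul_div, div_le_div_iff₀ (by positivity) hσ]
  have h3 : 0 ≤ Real.sqrt Real.pi * K * σ := by positivity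
  nlinarith [mul_le_mul_of_nonneg_left h2 h3]

/-- Replacing `η` by its mollification costs `2 s / σ`. The quadrature then passes under the
frequency integral, which lives on `|u| ≥ α₀`; there the exact Gaussian part integrates in closed
form. That part uses only `‖k‖ ≤ 1`, while the error part keeps `‖k‖` as an integrable weight. -/
theorem abs_ghDeriv_sub_le {M : ℕ} (hM : 2 ≤ M) {σ : ℝ} (hσ : 0 < σ) {α₀ γ : ℝ} (hα₀ : 0 < α₀)
    (hγ : 0 ≤ γ) {η : ℝ → ℝ} (hη : IsHighFreqBandlimited α₀ γ η) {k : ℝ → ℂ} (hk : Integrable k)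
    (hk1 : ∀ u, ‖k u‖ ≤ 1) {s : ℝ}
    (hki : Integrable (fun u => k u * 𝓕 (fun y : ℝ => (η y : ℂ)) u))
    (hs : ∀ y : ℝ, ‖(η y : ℂ) - ∫ u : ℝ, Complex.exp ((2 * Real.pi * u * y : ℝ) * Complex.I) *
      (k u * 𝓕 (fun y : ℝ => (η y : ℂ)) u)‖ ≤ s) :
    |ghDeriv M σ η| ≤ γ / (Real.pi * σ ^ 2) * Real.exp (-(2 * Real.pi ^ 2 * σ ^ 2) * α₀ ^ 2) +
      (2 * γ / (Real.sqrt Real.pi * σ) *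
        (∫ u, ‖k u‖ * ghCharErr (M - 2) (2 * Real.pi * Real.sqrt 2 * σ * |u|)) + 2 * s / σ) := by
  obtain ⟨m, rfl⟩ : ∃ m, M = m + 2 := ⟨M - 2, by omega⟩
  rw [Nat.add_sub_cancel]
  set g : ℝ → ℂ := fun u => k u * 𝓕 (fun y : ℝ => (η y : ℂ)) u with hg
  set c : ℝ := 2 * Real.pi * Real.sqrt 2 * σ with hc
  have hpi := Real.pi_pos
  have hc0 : 0 < c := by positivity
  have hspi : 0 < Real.sqrt Real.pi := Real.sqrt_pos.mpr Real.pi_pos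
  have hs0 : 0 ≤ s := (norm_nonneg _).trans (hs 0)
  -- This is `c² / 4`, the decay rate of the Gaussian factor at frequency `θ = c u`.
  set b : ℝ := 2 * Real.pi ^ 2 * σ ^ 2 with hb
  have hb0 : 0 < b := by positivity
  let h : ℝ → ℂ := fun y => ∫ u : ℝ, Complex.exp ((2 * Real.pi * u * y : ℝ) * Complex.I) * g u
  have hexpint : ∀ t : ℝ, Integrable fun u : ℝ => Complex.exp ((u * t : ℝ) * Complex.I) * g u := by
    intro t
    refine hki.bdd_mul (c := 1) (Continuous.aestronglyMeasurable (by fun_prop))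
      (Filter.Eventually.of_forall fun u => ?_)
    rw [Complex.norm_exp_ofReal_mul_I]
  have hsumh : ∑ v ∈ ghNodes (m + 2), ((ghWeight (m + 2) v * v : ℝ) : ℂ) *
      h (Real.sqrt 2 * σ * v) = ∫ u, ghCharSum (m + 2) (c * u) * g u := by
    simp_rw [ghCharSum, Finset.sum_mul]
    have e : ∀ v u : ℝ, ((ghWeight (m + 2) v * v : ℝ) : ℂ) *
        Complex.exp ((c * u * v : ℝ) * Complex.I) * g u =
        ((ghWeight (m + 2) v * v : ℝ) : ℂ) *
          (Complex.exp ((u * (c * v) : ℝ) * Complex.I) * g u) := by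
      intro v u
      rw [mul_assoc, show c * u * v = u * (c * v) by ring]
    simp_rw [e]
    rw [integral_finsetSum _ fun v _ => (hexpint _).const_mul _]
    refine Finset.sum_congr rfl fun v _ => ?_
    rw [integral_const_mul]
    congr 1
    have e' : ∀ u, 2 * Real.pi * u * (Real.sqrt 2 * σ * v) = u * (c * v) := by
      intro u
      rw [hc]
      ring
    simp only [h, e']
  have hA : ‖∫ u, ghCharSum (m + 2) (c * u) * g u‖ ≤
      γ * (Real.sqrt Real.pi / 2 * c) * (Real.exp (-b * α₀ ^ 2) / b) +
        γ * ∫ u, ‖k u‖ * ghCharErr m (c * |u|) := by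
    have hmeas : MeasurableSet {u : ℝ | α₀ ≤ |u|} :=
      measurableSet_le measurable_const (by fun_prop)
    have i1 : Integrable fun u : ℝ => γ * (Real.sqrt Real.pi / 2 * c) *
        {u : ℝ | α₀ ≤ |u|}.indicator (fun u => |u| * Real.exp (-b * u ^ 2)) u :=
      ((integrable_abs_mul_exp_neg_mul_sq hb0).indicator hmeas).const_mul _
    have i2 : Integrable fun u : ℝ => γ * (‖k u‖ * ghCharErr m (c * |u|)) :=
      (integrable_norm_mul_ghCharErr hk m hc0.le).const_mul _
    rw [← integral_indicator_abs_mul_exp_neg_mul_sq hb0 hα₀, ← integral_const_mul,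
      ← integral_const_mul, ← integral_add i1 i2]
    refine norm_integral_le_of_norm_le (i1.add i2) (Filter.Eventually.of_forall fun u => ?_)
    have herr := ghCharErr_nonneg m (θ := c * |u|) (by positivity)
    by_cases hu : α₀ ≤ |u|
    · rw [Set.indicator_of_mem (show u ∈ {u : ℝ | α₀ ≤ |u|} from hu)]
      have h1 := norm_ghCharSum_le_add m (c * u)
      have hexp : -(c * u) ^ 2 / 4 = -b * u ^ 2 := by
        rw [hc, hb, mul_pow, mul_pow, mul_pow, mul_pow, Real.sq_sqrt (by norm_num)]
        ring
      rw [hexp, abs_mul, abs_of_pos hc0] at h1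
      have h2 : ‖g u‖ ≤ ‖k u‖ * γ := by
        rw [hg, norm_mul]
        exact mul_le_mul_of_nonneg_left (hη.bounded u) (norm_nonneg _)
      rw [norm_mul]
      refine (mul_le_mul h1 h2 (norm_nonneg _) (by positivity)).trans ?_
      have h3 : Real.sqrt Real.pi / 2 * (c * |u| * Real.exp (-b * u ^ 2)) * γ * ‖k u‖ ≤
          Real.sqrt Real.pi / 2 * (c * |u| * Real.exp (-b * u ^ 2)) * γ * 1 :=
        mul_le_mul_of_nonneg_left (hk1 u) (by positivity)
      nlinarith [h3]
    · rw [Set.indicator_of_notMem (show u ∉ {u : ℝ | α₀ ≤ |u|} from hu)]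
      have h0 : g u = 0 := by
        simp only [hg]
        rw [hη.vanish u (abs_lt.mp (not_le.mp hu)), mul_zero]
      rw [h0, mul_zero, norm_zero]
      positivity
  have hB : ‖((∑ v ∈ ghNodes (m + 2), ghWeight (m + 2) v * v * η (Real.sqrt 2 * σ * v) : ℝ) : ℂ) -
      ∑ v ∈ ghNodes (m + 2), ((ghWeight (m + 2) v * v : ℝ) : ℂ) * h (Real.sqrt 2 * σ * v)‖ ≤
      3 / 4 * Real.sqrt Real.pi * s := by
    rw [Complex.ofReal_sum, ← Finset.sum_sub_distrib]
    refine (norm_sum_le _ _).trans ?_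
    refine le_trans (Finset.sum_le_sum fun v hv => ?_)
      ((Finset.sum_mul _ _ s).ge.trans
        (mul_le_mul_of_nonneg_right (sum_ghWeight_mul_abs_le hM) hs0))
    rw [Complex.ofReal_mul, ← mul_sub, norm_mul, Complex.norm_real, Real.norm_eq_abs, abs_mul,
      abs_of_nonneg (ghWeight_nonneg hv)]
    exact mul_le_mul_of_nonneg_left (hs _) (mul_nonneg (ghWeight_nonneg hv) (abs_nonneg _))
  have hC := (norm_le_norm_add_norm_sub' _ _).trans (add_le_add (hsumh ▸ hA) hB)
  rw [Complex.norm_real, Real.norm_eq_abs] at hC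
  rw [ghDeriv_eq, abs_mul, abs_of_nonneg (by positivity)]
  refine (mul_le_mul_of_nonneg_left hC (by positivity)).trans ?_
  set J := ∫ u, ‖k u‖ * ghCharErr m (c * |u|) with hJ
  have hJ0 : 0 ≤ J := integral_nonneg fun u =>
    mul_nonneg (norm_nonneg _) (ghCharErr_nonneg m (by positivity))
  have h22 : Real.sqrt 2 ≤ 3 / 2 := by
    rw [Real.sqrt_le_left (by norm_num)]
    norm_num
  have t1 : Real.sqrt 2 / (Real.sqrt Real.pi * σ) *
      (γ * (Real.sqrt Real.pi / 2 * c) * (Real.exp (-b * α₀ ^ 2) / b)) =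
      γ / (Real.pi * σ ^ 2) * Real.exp (-b * α₀ ^ 2) := by
    rw [hc, show Real.sqrt 2 / (Real.sqrt Real.pi * σ) * (γ * (Real.sqrt Real.pi / 2 *
      (2 * Real.pi * Real.sqrt 2 * σ)) * (Real.exp (-b * α₀ ^ 2) / b)) =
      (Real.sqrt 2 * Real.sqrt 2) * (Real.sqrt Real.pi / Real.sqrt Real.pi) * (σ / σ) *
      γ * Real.pi * (Real.exp (-b * α₀ ^ 2) / b) by ring, div_self hspi.ne', div_self hσ.ne',
      Real.mul_self_sqrt (by norm_num), show Real.exp (-b * α₀ ^ 2) / b =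
        Real.exp (-b * α₀ ^ 2) / (2 * Real.pi ^ 2 * σ ^ 2) by rw [hb]]
    field_simp
  have t2 : Real.sqrt 2 / (Real.sqrt Real.pi * σ) * (γ * J) ≤
      2 * γ / (Real.sqrt Real.pi * σ) * J := by
    rw [div_mul_eq_mul_div, div_mul_eq_mul_div, mul_assoc 2]
    gcongr
    linarith
  have t3 : Real.sqrt 2 / (Real.sqrt Real.pi * σ) * (3 / 4 * Real.sqrt Real.pi * s) ≤
      2 * s / σ := by
    rw [show Real.sqrt 2 / (Real.sqrt Real.pi * σ) * (3 / 4 * Real.sqrt Real.pi * s) =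
      (Real.sqrt 2 * (3 / 4)) * (Real.sqrt Real.pi / Real.sqrt Real.pi) * s / σ by ring,
      div_self hspi.ne']
    gcongr
    linarith
  rw [mul_add, mul_add, t1]
  linarith

/-- A uniformly equicontinuous family of bandlimited signals is uniformly bounded. -/
theorem exists_forall_abs_le_of_equicontinuous {α₀ γ : ℝ} (hγ : 0 < γ) {S : Set (ℝ → ℝ)}
    (hS : ∀ η ∈ S, IsHighFreqBandlimited α₀ γ η)
    (hmod : ∀ s > 0, ∃ δ > 0, ∀ η ∈ S, ∀ y y' : ℝ, |y - y'| < δ → |η y - η y'| ≤ s) :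
    ∃ K > 0, ∀ η ∈ S, ∀ y, |η y| ≤ K := by
  obtain ⟨δ, hδ, hmod⟩ := hmod 1 one_pos
  obtain ⟨k, hk, -, happ⟩ := exists_mollifier_fourier hδ
  have hk0 : 0 ≤ ∫ u, ‖k u‖ * γ := integral_nonneg fun u => by positivity
  refine ⟨1 + ∫ u, ‖k u‖ * γ, by positivity, fun η hη y => ?_⟩
  obtain ⟨-, hs⟩ := happ η γ 1 (hS η hη).continuous (hS η hη).integrable (hS η hη).bounded
    (hmod η hη)
  have h1 := norm_le_norm_add_norm_sub' _ _ |>.trans (add_le_add_right (hs y) _)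
  rw [Complex.norm_real, Real.norm_eq_abs] at h1
  refine h1.trans ?_
  rw [add_comm]
  gcongr
  refine norm_integral_le_of_norm_le (hk.norm.mul_const _) (Filter.Eventually.of_forall fun u => ?_)
  rw [norm_mul, Complex.norm_exp_ofReal_mul_I, one_mul, norm_mul]
  exact mul_le_mul_of_nonneg_left ((hS η hη).bounded u) (norm_nonneg _)

/-- Uniformly in the signal and in the smoothing radius from a compact interval, the quadrature
error tends to zero as the number of nodes grows. -/
theorem exists_forall_abs_ghDeriv_le {α₀ γ L σ₁ σ₂ : ℝ} (hα₀ : 0 < α₀) (hγ : 0 < γ) (hL : 0 < L)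
    (hσ₁ : 0 < σ₁) (hσ₂ : 0 < σ₂) {S : Set (ℝ → ℝ)} (hS : ∀ η ∈ S, IsHighFreqBandlimited α₀ γ η)
    (hmod : ∀ s > 0, ∃ δ > 0, ∀ η ∈ S, ∀ y y' : ℝ, |y - y'| < δ → |η y - η y'| ≤ s) :
    ∃ M₀ : ℕ, ∀ M ≥ M₀, 2 ≤ M → ∀ σ, σ₁ ≤ σ → σ ≤ σ₂ → ∀ η ∈ S,
      |ghDeriv M σ η| ≤
        γ / (Real.pi * σ ^ 2) * Real.exp (-(2 * Real.pi ^ 2 * σ ^ 2) * α₀ ^ 2) + L * σ := by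
  have hspi : 0 < Real.sqrt Real.pi := Real.sqrt_pos.mpr Real.pi_pos
  have hpi := Real.pi_pos
  -- This tolerance and the threshold for `m₀` below each contribute at most `L σ / 2` when `σ ≥
  -- σ₁`. The error integral increases with `σ`, so it is controlled at `σ₂`.
  obtain ⟨δ, hδ, hmod⟩ := hmod (L * σ₁ ^ 2 / 4) (by positivity)
  obtain ⟨k, hk, hk1, happ⟩ := exists_mollifier_fourier hδ
  have hlim := tendsto_integral_norm_mul_ghCharErr hk
    (c := 2 * Real.pi * Real.sqrt 2 * σ₂) (by positivity)
  obtain ⟨m₀, hm₀⟩ := Filter.eventually_atTop.mp (hlim.eventually (gt_mem_nhds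
    (show 0 < L * σ₁ ^ 2 * Real.sqrt Real.pi / (4 * γ) by positivity)))
  refine ⟨m₀ + 2, fun M hM hM2 σ hσ hσ' η hη => ?_⟩
  have hσ0 : 0 < σ := hσ₁.trans_le hσ
  obtain ⟨hki, hs⟩ := happ η γ _ (hS η hη).continuous (hS η hη).integrable (hS η hη).bounded
    (hmod η hη)
  refine (abs_ghDeriv_sub_le hM2 hσ0 hα₀ hγ.le (hS η hη) hk hk1 hki hs).trans ?_
  gcongr
  have hJ : ∫ u, ‖k u‖ * ghCharErr (M - 2) (2 * Real.pi * Real.sqrt 2 * σ * |u|) ≤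
      L * σ₁ ^ 2 * Real.sqrt Real.pi / (4 * γ) := by
    refine le_trans (integral_mono (integrable_norm_mul_ghCharErr hk _ (by positivity))
      (integrable_norm_mul_ghCharErr hk _ (by positivity)) fun u => ?_)
      (hm₀ (M - 2) (by omega)).le
    exact mul_le_mul_of_nonneg_left (ghCharErr_mono _ (by positivity) (by gcongr)) (norm_nonneg _)
  have hsq : σ₁ ^ 2 ≤ σ ^ 2 := by gcongr
  have h1 : 2 * γ / (Real.sqrt Real.pi * σ) *
      (∫ u, ‖k u‖ * ghCharErr (M - 2) (2 * Real.pi * Real.sqrt 2 * σ * |u|)) ≤ L * σ / 2 := by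
    refine (mul_le_mul_of_nonneg_left hJ (by positivity)).trans ?_
    rw [show 2 * γ / (Real.sqrt Real.pi * σ) * (L * σ₁ ^ 2 * Real.sqrt Real.pi / (4 * γ)) =
      L * σ₁ ^ 2 / (2 * σ) by field_simp; norm_num, div_le_div_iff₀ (by positivity) two_pos]
    nlinarith
  have h2 : 2 * (L * σ₁ ^ 2 / 4) / σ ≤ L * σ / 2 := by
    rw [div_le_div_iff₀ hσ0 two_pos]
    nlinarith
  linarith

theorem exists_forall_lt_mul_sq_le_exp {γ K : ℝ} (hγ : 0 < γ) (a : ℝ) :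
    ∃ σ₁ > 0, ∀ σ, 0 < σ → σ < σ₁ → K * σ ^ 2 ≤ γ ^ 2 * Real.exp (-(a * σ ^ 2)) := by
  have hc : Continuous fun σ : ℝ => γ ^ 2 * Real.exp (-(a * σ ^ 2)) - K * σ ^ 2 := by fun_prop
  have h := hc.continuousAt.eventually (lt_mem_nhds (a := 0) (b :=
    γ ^ 2 * Real.exp (-(a * (0 : ℝ) ^ 2)) - K * (0 : ℝ) ^ 2) (by
      simpa using pow_pos hγ 2))
  obtain ⟨σ₁, h1, h2⟩ := Metric.eventually_nhds_iff.mp h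
  refine ⟨σ₁, h1, fun σ h0 hlt => ?_⟩
  have := h2 (y := σ) (by rwa [Real.dist_eq, sub_zero, abs_of_pos h0])
  linarith

/-- Each of the three terms on the right wins in its own regime of `(M, σ)`: the exponential term
for small `σ`, the term in `L² σ²` for large `σ`, and the term with `C` for moderate `σ` and small
`M`. For moderate `σ` and large `M`, the asymptotic estimate gives the exponential and quadratic
terms together. -/
theorem exists_forall_ghDeriv_sq_le {α₀ γ L : ℝ} (hα₀ : 0 < α₀) (hγ : 0 < γ) (hL : 0 < L)
    {S : Set (ℝ → ℝ)} (hS : ∀ η ∈ S, IsHighFreqBandlimited α₀ γ η)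
    (hmod : ∀ s > 0, ∃ δ > 0, ∀ η ∈ S, ∀ y y' : ℝ, |y - y'| < δ → |η y - η y'| ≤ s) :
    ∃ C > 0, ∀ M : ℕ, 2 ≤ M → ∀ σ, 0 < σ → ∀ η ∈ S,
      3 / 2 * ghDeriv M σ η ^ 2 ≤
        C * (Real.pi * (M.factorial : ℝ) ^ 2 / (4 ^ M * ((2 * M).factorial : ℝ) ^ 2)
          * σ ^ (4 * M - 2)) + 45 * L ^ 2 * σ ^ 2
        + 3 * γ ^ 2 / (Real.pi ^ 2 * σ ^ 4) * Real.exp (-(4 * Real.pi ^ 2 * α₀ ^ 2 * σ ^ 2)) := by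
  have hpi := Real.pi_pos
  obtain ⟨K, hK, hbd⟩ := exists_forall_abs_le_of_equicontinuous hγ hS hmod
  obtain ⟨σ₁, hσ₁, hsmall⟩ := exists_forall_lt_mul_sq_le_exp (K := 2 * K ^ 2 * Real.pi ^ 2) hγ
    (4 * Real.pi ^ 2 * α₀ ^ 2)
  -- Beyond `σ₂` both `σ ≥ 1` and `L σ ≥ K` hold, so the crude bound `6 K² / σ²` is at most `6 L²
  -- σ²`.
  set σ₂ := 1 + K / L with hσ₂
  have hσ₂0 : 0 < σ₂ := by positivity
  obtain ⟨M₀, hM₀⟩ := exists_forall_abs_ghDeriv_le hα₀ hγ hL hσ₁ hσ₂0 hS hmod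
  let q : ℕ → ℝ → ℝ := fun M σ =>
    Real.pi * (M.factorial : ℝ) ^ 2 / (4 ^ M * ((2 * M).factorial : ℝ) ^ 2) * σ ^ (4 * M - 2)
  have hq : ∀ M σ, 0 < σ → 0 < q M σ := fun M σ h => by positivity
  -- Chosen so that `c M * q M σ₁` is the crude bound at `σ₁`. As `q M` increases with `σ` and the
  -- crude bound decreases, `c M` suffices for all `σ ≥ σ₁`.
  let c : ℕ → ℝ := fun M => 6 * K ^ 2 / σ₁ ^ 2 / q M σ₁
  have hc : ∀ M, 0 ≤ c M := fun M => by
    have := hq M σ₁ hσ₁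
    positivity
  have hCsum : 0 ≤ ∑ M ∈ Finset.range M₀, c M := Finset.sum_nonneg fun M _ => hc M
  refine ⟨1 + ∑ M ∈ Finset.range M₀, c M, by linarith, fun M hM σ hσ η hη => ?_⟩
  change _ ≤ (1 + ∑ M ∈ Finset.range M₀, c M) * q M σ + _ + _
  have hqσ := hq M σ hσ
  have hq0 : 0 ≤ (1 + ∑ M ∈ Finset.range M₀, c M) * q M σ := by positivity
  have hE0 : 0 ≤ 3 * γ ^ 2 / (Real.pi ^ 2 * σ ^ 4) *
    Real.exp (-(4 * Real.pi ^ 2 * α₀ ^ 2 * σ ^ 2)) := by positivity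
  have hL0 : 0 ≤ 45 * L ^ 2 * σ ^ 2 := by positivity
  have hcrude : 3 / 2 * ghDeriv M σ η ^ 2 ≤ 6 * K ^ 2 / σ ^ 2 := by
    have h := abs_ghDeriv_le_of_abs_le hM hσ (hbd η hη)
    have h2 : ghDeriv M σ η ^ 2 ≤ (2 * K / σ) ^ 2 := by
      rw [← sq_abs]
      gcongr
    rw [div_pow, mul_pow] at h2
    rw [mul_div_assoc]
    rw [mul_div_assoc] at h2
    linarith
  rcases lt_or_ge σ σ₁ with h1 | h1
  · have h := hsmall σ hσ h1
    have : 6 * K ^ 2 / σ ^ 2 ≤ 3 * γ ^ 2 / (Real.pi ^ 2 * σ ^ 4) *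
        Real.exp (-(4 * Real.pi ^ 2 * α₀ ^ 2 * σ ^ 2)) := by
      rw [div_mul_eq_mul_div, div_le_div_iff₀ (by positivity) (by positivity)]
      have h' := mul_le_mul_of_nonneg_right h (by positivity : 0 ≤ 3 * σ ^ 2)
      nlinarith [h']
    linarith
  rcases lt_or_ge σ₂ σ with h2 | h2
  · have : 6 * K ^ 2 / σ ^ 2 ≤ 45 * L ^ 2 * σ ^ 2 := by
      rw [div_le_iff₀ (by positivity)]
      have hKσ : K ≤ L * σ := by
        have := (div_lt_iff₀ hL).mp (show K / L < σ by linarith)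
        linarith
      have hσ1 : 1 ≤ σ := by
        have : 0 < K / L := by positivity
        linarith
      have hσ2 : 1 ≤ σ ^ 2 := one_le_pow₀ hσ1
      have hK2 : K ^ 2 ≤ (L * σ) ^ 2 := by gcongr
      have : 0 ≤ (L * σ) ^ 2 := by positivity
      nlinarith [mul_le_mul_of_nonneg_left hσ2 this]
    linarith
  rcases lt_or_ge M M₀ with h3 | h3
  · have hcM : c M ≤ 1 + ∑ M ∈ Finset.range M₀, c M := by
      have := Finset.single_le_sum (f := c) (fun M _ => hc M) (Finset.mem_range.mpr h3)
      linarith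
    have hqm : q M σ₁ ≤ q M σ := by
      simp only [q]
      gcongr
    have h4 : 6 * K ^ 2 / σ ^ 2 ≤ 6 * K ^ 2 / σ₁ ^ 2 := by gcongr
    have h5 : 6 * K ^ 2 / σ₁ ^ 2 = c M * q M σ₁ := by
      simp only [c]
      rw [div_mul_cancel₀ _ (hq M σ₁ hσ₁).ne']
    have h6 : c M * q M σ₁ ≤ (1 + ∑ M ∈ Finset.range M₀, c M) * q M σ :=
      mul_le_mul hcM hqm (hq M σ₁ hσ₁).le (by linarith)
    linarith
  · have h := hM₀ M h3 hM σ h1 h2 η hη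
    set P := γ / (Real.pi * σ ^ 2) * Real.exp (-(2 * Real.pi ^ 2 * σ ^ 2) * α₀ ^ 2) with hP
    have hP2 : 3 * P ^ 2 = 3 * γ ^ 2 / (Real.pi ^ 2 * σ ^ 4) *
        Real.exp (-(4 * Real.pi ^ 2 * α₀ ^ 2 * σ ^ 2)) := by
      rw [hP, mul_pow, ← Real.exp_nat_mul, div_pow]
      push_cast
      rw [show (2 : ℝ) * (-(2 * Real.pi ^ 2 * σ ^ 2) * α₀ ^ 2) =
        -(4 * Real.pi ^ 2 * α₀ ^ 2 * σ ^ 2) by ring]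
      ring
    have h7 : ghDeriv M σ η ^ 2 ≤ (P + L * σ) ^ 2 := by
      rw [← sq_abs]
      gcongr
    rw [← hP2]
    nlinarith [sq_nonneg (P - L * σ), sq_nonneg (L * σ)]

/-! ### Functions with Lipschitz gradient -/

theorem HasLipschitzGradient.abs_sub_sub_le {d : ℕ} {L : ℝ} {φ : EucSp d → ℝ}
    (hφ : HasLipschitzGradient L φ) (x v : EucSp d) :
    |φ (x + v) - φ x - inner ℝ (gradient φ x) v| ≤ L / 2 * ‖v‖ ^ 2 := by
  have hdiff : Differentiable ℝ φ := hφ.1.differentiable one_ne_zero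
  have hline : ∀ t : ℝ, HasDerivAt (fun t : ℝ => x + t • v) v t := by
    intro t
    simpa using ((hasDerivAt_id t).smul_const v).const_add x
  have hd : ∀ t : ℝ, HasDerivAt
      (fun t : ℝ => φ (x + t • v) - φ x - t * inner ℝ (gradient φ x) v)
      (inner ℝ (gradient φ (x + t • v)) v - inner ℝ (gradient φ x) v) t := by
    intro t
    have h1 := (hdiff (x + t • v)).hasGradientAt.hasFDerivAt.comp_hasDerivAt t (hline t)
    rw [InnerProductSpace.toDual_apply_apply] at h1
    exact (h1.sub_const (φ x)).sub (hasDerivAt_mul_const _)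
  have hB : ∀ t : ℝ, HasDerivAt (fun t : ℝ => L / 2 * ‖v‖ ^ 2 * t ^ 2) (L * ‖v‖ ^ 2 * t) t := by
    intro t
    refine ((hasDerivAt_pow 2 t).const_mul _).congr_deriv ?_
    norm_num
    ring
  have := image_norm_le_of_norm_deriv_right_le_deriv_boundary (a := 0) (b := 1)
    (fun t _ => (hd t).continuousAt.continuousWithinAt) (fun t _ => (hd t).hasDerivWithinAt)
    (by simp) hB (fun t ht => by
      rw [← inner_sub_left]
      refine (norm_inner_le_norm _ _).trans ?_
      have h := hφ.2 (x + t • v) x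
      rw [add_sub_cancel_left, norm_smul, Real.norm_eq_abs, abs_of_nonneg ht.1] at h
      refine (mul_le_mul_of_nonneg_right h (norm_nonneg v)).trans_eq ?_
      ring) (Set.right_mem_Icc.mpr zero_le_one)
  simpa using this

/-- A gradient step of length `1 / L` lowers `φ` by at least `‖∇φ x‖² / (2 L)`, and cannot go below
the minimum. -/
theorem HasLipschitzGradient.norm_gradient_sq_le {d : ℕ} {L : ℝ} (hL : 0 < L) {φ : EucSp d → ℝ}
    (hφ : HasLipschitzGradient L φ) {xstar : EucSp d} (hmin : ∀ y, φ xstar ≤ φ y) (x : EucSp d) :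
    ‖gradient φ x‖ ^ 2 ≤ 2 * L * (φ x - φ xstar) := by
  have h := (abs_le.mp (hφ.abs_sub_sub_le x (-(1 / L) • gradient φ x))).2
  have hm := hmin (x + -(1 / L) • gradient φ x)
  rw [inner_smul_right, real_inner_self_eq_norm_sq, norm_smul, mul_pow, Real.norm_eq_abs,
    sq_abs] at h
  have h' : ‖gradient φ x‖ ^ 2 / (2 * L) ≤ φ x - φ xstar := by
    have e : ‖gradient φ x‖ ^ 2 / (2 * L) =
        -(L / 2 * ((-(1 / L)) ^ 2 * ‖gradient φ x‖ ^ 2)) - -(1 / L) * ‖gradient φ x‖ ^ 2 := by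
      field_simp
      ring
    rw [e]
    linarith
  rw [div_le_iff₀ (by positivity)] at h'
  linarith

theorem IsStronglyConvexGrad.le_of_hasLipschitzGradient {d : ℕ} {L τ : ℝ} {φ : EucSp d → ℝ}
    (hτ : IsStronglyConvexGrad τ φ) (hφ : HasLipschitzGradient L φ) {v : EucSp d} (hv : ‖v‖ = 1) :
    τ ≤ L := by
  have h1 := hτ 0 v
  have h2 := (abs_le.mp (hφ.abs_sub_sub_le 0 v)).2
  rw [zero_add] at h2
  rw [sub_zero] at h1
  rw [hv] at h1 h2
  linarith

/-! ### The estimated gradient -/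

/-- The vanishing first moment kills `φ x`, the second moment reproduces the directional derivative
exactly, and the quadratic remainder meets the third absolute moment. The resulting constant `5 √2 /
8` is below one. -/
theorem abs_ghDeriv_crossSection_sub_inner_le {d : ℕ} {L : ℝ} (hL : 0 ≤ L) {φ : EucSp d → ℝ}
    (hφ : HasLipschitzGradient L φ) {M : ℕ} (hM : 2 ≤ M) {σ : ℝ} (hσ : 0 < σ) (x : EucSp d)
    {e : EucSp d} (he : ‖e‖ = 1) :
    |ghDeriv M σ (crossSection φ x e) - inner ℝ e (gradient φ x)| ≤ L * σ := by
  have hspi : 0 < Real.sqrt Real.pi := Real.sqrt_pos.mpr Real.pi_pos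
  have h2 : Real.sqrt 2 * Real.sqrt 2 = 2 := Real.mul_self_sqrt (by norm_num)
  have h22 : Real.sqrt 2 ≤ 8 / 5 := by
    rw [Real.sqrt_le_left (by norm_num)]
    norm_num
  set g := inner ℝ e (gradient φ x) with hg
  let R : ℝ → ℝ := fun v => crossSection φ x e (Real.sqrt 2 * σ * v) - φ x - Real.sqrt 2 * σ * v * g
  have hR : ∀ v, |R v| ≤ L * σ ^ 2 * v ^ 2 := by
    intro v
    have h := hφ.abs_sub_sub_le x ((Real.sqrt 2 * σ * v) • e)
    rw [inner_smul_right, real_inner_comm, norm_smul, he, mul_one, Real.norm_eq_abs, sq_abs,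
      mul_pow, mul_pow, Real.sq_sqrt (by norm_num)] at h
    refine h.trans_eq ?_
    ring
  have hsum : ∑ v ∈ ghNodes M, ghWeight M v * v * crossSection φ x e (Real.sqrt 2 * σ * v) =
      Real.sqrt 2 * σ * g * (Real.sqrt Real.pi / 2) + ∑ v ∈ ghNodes M, ghWeight M v * v * R v := by
    rw [← sum_ghWeight_mul_sq hM, Finset.mul_sum, ← Finset.sum_add_distrib, ← sub_eq_zero,
      ← Finset.sum_sub_distrib]
    have : ∀ v ∈ ghNodes M, ghWeight M v * v * crossSection φ x e (Real.sqrt 2 * σ * v) -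
        (Real.sqrt 2 * σ * g * (ghWeight M v * v ^ 2) + ghWeight M v * v * R v) =
        φ x * (ghWeight M v * v) := by
      intro v _
      simp only [R]
      ring
    rw [Finset.sum_congr rfl this, ← Finset.mul_sum, sum_ghWeight_mul_self (by omega), mul_zero]
  have hRsum : |∑ v ∈ ghNodes M, ghWeight M v * v * R v| ≤
      L * σ ^ 2 * (5 / 8 * Real.sqrt Real.pi) := by
    refine (Finset.abs_sum_le_sum_abs _ _).trans (le_trans (Finset.sum_le_sum fun v hv => ?_)
      ((Finset.mul_sum _ _ (L * σ ^ 2)).ge.trans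
        (mul_le_mul_of_nonneg_left (sum_ghWeight_mul_abs_pow_three_le hM) (by positivity))))
    have hw := ghWeight_nonneg hv
    rw [abs_mul, abs_mul, abs_of_nonneg hw]
    refine (mul_le_mul_of_nonneg_left (hR v) (by positivity)).trans_eq ?_
    rw [← sq_abs v]
    ring
  have hE : ghDeriv M σ (crossSection φ x e) - g =
      Real.sqrt 2 / (Real.sqrt Real.pi * σ) * ∑ v ∈ ghNodes M, ghWeight M v * v * R v := by
    rw [ghDeriv_eq, hsum, mul_add, add_sub_right_comm, add_eq_right, sub_eq_zero,
      show Real.sqrt 2 / (Real.sqrt Real.pi * σ) * (Real.sqrt 2 * σ * g * (Real.sqrt Real.pi / 2)) =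
      (Real.sqrt 2 * Real.sqrt 2) / 2 * (Real.sqrt Real.pi / Real.sqrt Real.pi) * (σ / σ) * g by
        ring, div_self hspi.ne', div_self hσ.ne', h2]
    norm_num
  rw [hE, abs_mul, abs_of_nonneg (by positivity)]
  refine (mul_le_mul_of_nonneg_left hRsum (by positivity)).trans ?_
  rw [show Real.sqrt 2 / (Real.sqrt Real.pi * σ) * (L * σ ^ 2 * (5 / 8 * Real.sqrt Real.pi)) =
    (Real.sqrt 2 * (5 / 8)) * (Real.sqrt Real.pi / Real.sqrt Real.pi) * (σ / σ) * (L * σ) by ring,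
    div_self hspi.ne', div_self hσ.ne', mul_one, mul_one]
  exact mul_le_of_le_one_left (by positivity) (by linarith)

theorem ghDeriv_crossSection_add {d : ℕ} (M : ℕ) (σ : ℝ) (F G : EucSp d → ℝ) (x e : EucSp d) :
    ghDeriv M σ (crossSection (fun y => F y + G y) x e) =
      ghDeriv M σ (crossSection F x e) + ghDeriv M σ (crossSection G x e) := by
  simp only [ghDeriv, crossSection]
  rw [← mul_add, ← Finset.sum_add_distrib]
  congr 1
  refine Finset.sum_congr rfl fun v _ => ?_
  ring

theorem norm_sum_smul_orthonormalBasis_sq {d : ℕ} (ξ : OrthonormalBasis (Fin d) ℝ (EucSp d))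
    (a : Fin d → ℝ) : ‖∑ i, a i • ξ i‖ ^ 2 = ∑ i, a i ^ 2 := by
  rw [← real_inner_self_eq_norm_sq, ξ.orthonormal.inner_sum]
  simp [sq]

theorem norm_dgsGradient_sub_gradient_sq_le {d : ℕ} {L : ℝ} (hL : 0 ≤ L) {φ ε : EucSp d → ℝ}
    (ξ : OrthonormalBasis (Fin d) ℝ (EucSp d)) (hφ : HasLipschitzGradient L φ) {M : ℕ}
    (hM : 2 ≤ M) {σ : ℝ} (hσ : 0 < σ) {B : ℝ} (x : EucSp d)
    (hB : ∀ i, 3 / 2 * ghDeriv M σ (crossSection ε x (ξ i)) ^ 2 ≤ B) :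
    ‖dgsGradient M σ ξ (fun y => φ y + ε y) x - gradient φ x‖ ^ 2 ≤
      d * (3 * L ^ 2 * σ ^ 2 + B) := by
  have hgrad : gradient φ x = ∑ i, inner ℝ (ξ i) (gradient φ x) • ξ i :=
    (ξ.sum_repr' (gradient φ x)).symm
  rw [dgsGradient, hgrad, ← Finset.sum_sub_distrib]
  simp_rw [← sub_smul]
  rw [norm_sum_smul_orthonormalBasis_sq]
  have hterm : ∀ i ∈ Finset.univ, (ghDeriv M σ (crossSection (fun y => φ y + ε y) x (ξ i)) -
      inner ℝ (ξ i) (gradient φ x)) ^ 2 ≤ 3 * L ^ 2 * σ ^ 2 + B := by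
    intro i _
    rw [ghDeriv_crossSection_add]
    have hA := abs_ghDeriv_crossSection_sub_inner_le hL hφ hM hσ x (ξ.orthonormal.1 i)
    have hA2 : (ghDeriv M σ (crossSection φ x (ξ i)) - inner ℝ (ξ i) (gradient φ x)) ^ 2 ≤
        (L * σ) ^ 2 := by
      rw [← sq_abs]
      gcongr
    have hG := hB i
    set A := ghDeriv M σ (crossSection φ x (ξ i)) - inner ℝ (ξ i) (gradient φ x) with hAdef
    set G := ghDeriv M σ (crossSection ε x (ξ i))
    rw [show ghDeriv M σ (crossSection φ x (ξ i)) + G - inner ℝ (ξ i) (gradient φ x) = A + G by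
      rw [hAdef]; ring]
    -- Young's inequality `(A + G)² ≤ 3 A² + 3/2 G²`; the `3` here and the `45` of the noise bound
    -- make up the `48` in `δ_σ`.
    nlinarith [sq_nonneg (2 * A - G)]
  simpa [mul_add] using Finset.sum_le_card_nsmul _ _ _ hterm

/-! ### Inexact gradient descent -/

/-- Expanding the square, strong convexity yields a gain `2 λ (φ x - φ x*) + λ τ ‖x - x*‖²`. With `λ
= 1 / (16 L)` the first part absorbs the `‖∇φ‖²` in the quadratic term; half of the second absorbs
the cross term with the error. The error carries the factor `τ / (32 L)` so that its geometric
accumulation gives back the bracket itself. -/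
theorem norm_inexact_step_sub_sq_le {d : ℕ} {L τ : ℝ} (hL : 0 < L) (hτ : 0 < τ) {φ : EucSp d → ℝ}
    (hφ : HasLipschitzGradient L φ) (hconv : IsStronglyConvexGrad τ φ) {xstar : EucSp d}
    (hmin : ∀ y, φ xstar ≤ φ y) (x g : EucSp d) :
    ‖x - (1 / (16 * L)) • g - xstar‖ ^ 2 ≤ (1 - τ / (32 * L)) * ‖x - xstar‖ ^ 2 +
      τ / (32 * L) * ((4 / τ ^ 2 + 1 / (4 * L * τ)) * ‖g - gradient φ x‖ ^ 2) := by
  set r := x - xstar with hr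
  set G := gradient φ x with hG
  set e := g - G with he
  have h1 : φ x - φ xstar + τ / 2 * ‖r‖ ^ 2 ≤ inner ℝ G r := by
    have h := hconv x xstar
    rw [← neg_sub x xstar, inner_neg_right, norm_neg] at h
    linarith
  have h2 := hφ.norm_gradient_sq_le hL hmin x
  have h3 : -(‖e‖ * ‖r‖) ≤ inner ℝ e r := (abs_le.mp (abs_real_inner_le_norm e r)).1
  have h4 : ‖g‖ ^ 2 ≤ 2 * ‖G‖ ^ 2 + 2 * ‖e‖ ^ 2 := by
    have : ‖g‖ ≤ ‖G‖ + ‖e‖ := by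
      rw [show g = G + e by rw [he]; abel]
      exact norm_add_le _ _
    nlinarith [sq_nonneg (‖G‖ - ‖e‖), norm_nonneg g]
  set lam := 1 / (16 * L) with hlam
  have hlam0 : 0 < lam := by positivity
  have hlamL : lam * L = 1 / 16 := by
    rw [hlam]
    field_simp
  have hexp : ‖x - lam • g - xstar‖ ^ 2 =
      ‖r‖ ^ 2 - 2 * lam * (inner ℝ G r + inner ℝ e r) + lam ^ 2 * ‖g‖ ^ 2 := by
    rw [show x - lam • g - xstar = r - lam • g by rw [hr]; abel, norm_sub_sq_real,
      inner_smul_right, norm_smul, mul_pow, Real.norm_eq_abs, sq_abs, ← inner_add_left,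
      real_inner_comm, show G + e = g by rw [he]; abel]
    ring
  have h5 : 2 * (‖e‖ * ‖r‖) ≤ τ / 2 * ‖r‖ ^ 2 + 2 / τ * ‖e‖ ^ 2 := by
    have e1 : τ / 2 * ‖r‖ ^ 2 + 2 / τ * ‖e‖ ^ 2 - 2 * (‖e‖ * ‖r‖) =
        (τ * ‖r‖ - 2 * ‖e‖) ^ 2 / (2 * τ) := by
      field_simp
      ring
    have e2 : 0 ≤ (τ * ‖r‖ - 2 * ‖e‖) ^ 2 / (2 * τ) := by positivity
    linarith
  have h6 : lam ^ 2 * ‖g‖ ^ 2 ≤ lam * (φ x - φ xstar) + 2 * lam ^ 2 * ‖e‖ ^ 2 := by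
    have a1 := mul_le_mul_of_nonneg_left h4 (sq_nonneg lam)
    have a2 := mul_le_mul_of_nonneg_left h2 (sq_nonneg lam)
    have a3 : lam ^ 2 * (2 * L * (φ x - φ xstar)) = lam * (φ x - φ xstar) / 8 := by
      rw [show lam ^ 2 * (2 * L * (φ x - φ xstar)) = (lam * L) * (2 * lam * (φ x - φ xstar)) by
        ring, hlamL]
      ring
    have a4 : 0 ≤ lam * (φ x - φ xstar) := mul_nonneg hlam0.le (by linarith [hmin x])
    nlinarith
  have h7 : τ / (32 * L) * ((4 / τ ^ 2 + 1 / (4 * L * τ)) * ‖e‖ ^ 2) =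
      (2 * lam / τ + 2 * lam ^ 2) * ‖e‖ ^ 2 := by
    rw [hlam]
    field_simp
    ring
  have h8 : τ / (32 * L) = lam * τ / 2 := by
    rw [hlam]
    field_simp
    norm_num
  rw [h7, h8, hexp]
  have h9 : lam * (2 * (‖e‖ * ‖r‖)) ≤ lam * (τ / 2 * ‖r‖ ^ 2 + 2 / τ * ‖e‖ ^ 2) :=
    mul_le_mul_of_nonneg_left h5 hlam0.le
  have h10 : 2 * lam * (φ x - φ xstar + τ / 2 * ‖r‖ ^ 2 - ‖e‖ * ‖r‖) ≤
      2 * lam * (inner ℝ G r + inner ℝ e r) :=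
    mul_le_mul_of_nonneg_left (by linarith) (by positivity)
  have a4 : 0 ≤ lam * (φ x - φ xstar) := mul_nonneg hlam0.le (by linarith [hmin x])
  have h11 : 2 * lam / τ * ‖e‖ ^ 2 = lam * (2 / τ * ‖e‖ ^ 2) := by ring
  rw [add_mul, h11]
  nlinarith

theorem le_pow_mul_add_of_contraction {q D : ℝ} (hq : q ≤ 1) {a : ℕ → ℝ}
    (hD : 0 ≤ D) (ha : ∀ t, a (t + 1) ≤ (1 - q) * a t + q * D) (t : ℕ) :
    a t ≤ (1 - q) ^ t * a 0 + D := by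
  induction t with
  | zero => simpa using hD
  | succ t ih =>
    have h := mul_le_mul_of_nonneg_left ih (sub_nonneg.mpr hq)
    rw [pow_succ]
    nlinarith [ha t]

/-! ### The radius of the neighborhood of convergence -/

theorem deltaSigma_nonneg {C L τ α₀ γ : ℝ} (hC : 0 ≤ C) (hL : 0 ≤ L) (hτ : 0 ≤ τ) (d M : ℕ)
    {σ : ℝ} (hσ : 0 ≤ σ) : 0 ≤ deltaSigma C L τ α₀ γ d M σ := by
  unfold deltaSigma ghTerm
  have := Real.pi_pos
  positivity

theorem logFactor_pos {L α₀ γ : ℝ} (hL : 0 < L) (hγ : 0 < γ)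
    (h : L ^ (1 / 3 : ℝ) / (Real.pi * γ ^ (1 / 3 : ℝ)) < α₀) : 0 < logFactor L α₀ γ := by
  have h1 : 0 < L ^ (1 / 3 : ℝ) := Real.rpow_pos_of_pos hL _
  have h2 : 0 < γ ^ (1 / 3 : ℝ) := Real.rpow_pos_of_pos hγ _
  have hpi := Real.pi_pos
  refine Real.log_pos ?_
  rw [div_lt_iff₀ (by positivity)] at h
  rw [one_lt_div h1]
  linarith

theorem rpow_one_third_pow_six {x : ℝ} (hx : 0 ≤ x) : (x ^ (1 / 3 : ℝ)) ^ 6 = x ^ 2 := by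
  rw [← Real.rpow_natCast, ← Real.rpow_mul hx, ← Real.rpow_natCast]
  norm_num

/-- The prescribed high-frequency radius makes the Gaussian exponent in `δ_σ` equal to `-6 ℓ`, and
the sixth power clears the cube roots in `ℓ`. -/
theorem exp_neg_six_mul_logFactor {L α₀ γ : ℝ} (hL : 0 < L) (hα₀ : 0 < α₀) (hγ : 0 < γ) :
    Real.exp (-(6 * logFactor L α₀ γ)) = L ^ 2 / (Real.pi ^ 6 * α₀ ^ 6 * γ ^ 2) := by
  have h1 : 0 < L ^ (1 / 3 : ℝ) := Real.rpow_pos_of_pos hL _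
  have h2 : 0 < γ ^ (1 / 3 : ℝ) := Real.rpow_pos_of_pos hγ _
  have hpi := Real.pi_pos
  have h6 := Real.exp_nat_mul (logFactor L α₀ γ) 6
  rw [logFactor, Real.exp_log (by positivity), div_pow, mul_pow, mul_pow,
    rpow_one_third_pow_six hL.le, rpow_one_third_pow_six hγ.le] at h6
  push_cast at h6
  rw [Real.exp_neg, logFactor, h6, inv_div]

theorem deltaSigma_le_of_high_frequency {C L τ α₀ γ : ℝ} (hL : 0 < L) (hα₀ : 0 < α₀) (hγ : 0 < γ)
    (hτ : 0 < τ) (d M : ℕ) (h : L ^ (1 / 3 : ℝ) / (Real.pi * γ ^ (1 / 3 : ℝ)) < α₀) {σ : ℝ}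
    (hσ : σ = Real.sqrt 3 / (Real.pi * α₀ * Real.sqrt 2) * Real.sqrt (logFactor L α₀ γ)) :
    deltaSigma C L τ α₀ γ d M σ ≤ (4 / τ ^ 2 + 1 / (4 * L * τ)) *
      (ghTerm C d M σ + 8 * L ^ 2 * (d : ℝ) / α₀ ^ 2
        * (logFactor L α₀ γ + ((logFactor L α₀ γ) ^ 2)⁻¹)) := by
  have hℓ := logFactor_pos hL hγ h
  have hexp := exp_neg_six_mul_logFactor hL hα₀ hγ
  set ℓ := logFactor L α₀ γ
  have hpi := Real.pi_pos
  have hpi2 : 9 ≤ Real.pi ^ 2 := by nlinarith [Real.pi_gt_three]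
  have hσ2 : σ ^ 2 = 3 * ℓ / (2 * Real.pi ^ 2 * α₀ ^ 2) := by
    rw [hσ, mul_pow, div_pow, mul_pow, mul_pow, Real.sq_sqrt (by norm_num),
      Real.sq_sqrt (by norm_num), Real.sq_sqrt hℓ.le]
    ring
  have e1 : -(4 * Real.pi ^ 2 * α₀ ^ 2 * σ ^ 2) = -(6 * ℓ) := by
    rw [hσ2]
    field_simp
    norm_num
  have e2 : σ ^ 4 = (3 * ℓ / (2 * Real.pi ^ 2 * α₀ ^ 2)) ^ 2 := by
    rw [← hσ2]
    ring
  have b1 : 48 * L ^ 2 * (d : ℝ) * σ ^ 2 ≤ 8 * L ^ 2 * (d : ℝ) / α₀ ^ 2 * ℓ := by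
    rw [hσ2, show 48 * L ^ 2 * (d : ℝ) * (3 * ℓ / (2 * Real.pi ^ 2 * α₀ ^ 2)) =
      8 * L ^ 2 * (d : ℝ) / α₀ ^ 2 * ℓ * (9 / Real.pi ^ 2) by field_simp; ring]
    exact mul_le_of_le_one_right (by positivity) (by rwa [div_le_one (by positivity)])
  have b2 : 3 * γ ^ 2 * (d : ℝ) / (Real.pi ^ 2 * σ ^ 4) *
      Real.exp (-(4 * Real.pi ^ 2 * α₀ ^ 2 * σ ^ 2)) ≤ 8 * L ^ 2 * (d : ℝ) / α₀ ^ 2 * (ℓ ^ 2)⁻¹ := by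
    rw [e1, hexp, e2, show 3 * γ ^ 2 * (d : ℝ) / (Real.pi ^ 2 *
      (3 * ℓ / (2 * Real.pi ^ 2 * α₀ ^ 2)) ^ 2) * (L ^ 2 / (Real.pi ^ 6 * α₀ ^ 6 * γ ^ 2)) =
      8 * L ^ 2 * (d : ℝ) / α₀ ^ 2 * (ℓ ^ 2)⁻¹ * (1 / (6 * (Real.pi ^ 2) ^ 2)) by
        field_simp; ring]
    refine mul_le_of_le_one_right (by positivity) ?_
    rw [div_le_one (by positivity)]
    nlinarith
  unfold deltaSigma
  refine mul_le_mul_of_nonneg_left ?_ (by positivity)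
  rw [mul_add, ← add_assoc]
  gcongr

theorem deltaSigma_le_of_low_frequency {C L τ α₀ γ : ℝ} (hL : 0 < L) (hα₀ : 0 < α₀) (hγ : 0 < γ)
    (hτ : 0 < τ) (d M : ℕ) (h : α₀ ≤ L ^ (1 / 3 : ℝ) / (Real.pi * γ ^ (1 / 3 : ℝ))) {σ : ℝ}
    (hσ : σ = 1 / α₀) :
    deltaSigma C L τ α₀ γ d M σ ≤ (4 / τ ^ 2 + 1 / (4 * L * τ)) *
      (ghTerm C d M σ + 49 * L ^ 2 * (d : ℝ) / α₀ ^ 2) := by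
  have h1 : 0 < L ^ (1 / 3 : ℝ) := Real.rpow_pos_of_pos hL _
  have h2 : 0 < γ ^ (1 / 3 : ℝ) := Real.rpow_pos_of_pos hγ _
  have hpi := Real.pi_pos
  rw [le_div_iff₀ (by positivity)] at h
  have h6 : (α₀ * (Real.pi * γ ^ (1 / 3 : ℝ))) ^ 6 ≤ (L ^ (1 / 3 : ℝ)) ^ 6 := by gcongr
  rw [mul_pow, mul_pow, rpow_one_third_pow_six hL.le, rpow_one_third_pow_six hγ.le] at h6
  have b : 3 * γ ^ 2 * (d : ℝ) / (Real.pi ^ 2 * σ ^ 4) *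
      Real.exp (-(4 * Real.pi ^ 2 * α₀ ^ 2 * σ ^ 2)) ≤ L ^ 2 * (d : ℝ) / α₀ ^ 2 := by
    have hpi6 : 3 ≤ Real.pi ^ 8 :=
      le_trans (by norm_num) (pow_le_pow_left₀ (by norm_num) Real.pi_gt_three.le 8)
    have hγL : 3 * γ ^ 2 * α₀ ^ 6 ≤ L ^ 2 * Real.pi ^ 2 := by
      have := mul_le_mul_of_nonneg_left hpi6 (by positivity : 0 ≤ γ ^ 2 * α₀ ^ 6)
      have := mul_le_mul_of_nonneg_left h6 (by positivity : 0 ≤ Real.pi ^ 2)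
      nlinarith
    -- The exponential is bounded by one: at low frequency the prefactor is already at most one unit
    -- `L² d / α₀²`, which with the `48` makes `49`.
    refine (mul_le_of_le_one_right (by rw [hσ]; positivity)
      (Real.exp_le_one_iff.mpr (by simp only [neg_nonpos]; positivity))).trans ?_
    rw [hσ, div_le_div_iff₀ (by positivity) (by positivity), one_div, inv_pow]
    have hd : (0 : ℝ) ≤ d := d.cast_nonneg
    rw [show L ^ 2 * (d : ℝ) * (Real.pi ^ 2 * (α₀ ^ 4)⁻¹) =
      (L ^ 2 * Real.pi ^ 2) * (d * (α₀ ^ 4)⁻¹) by ring,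
      show 3 * γ ^ 2 * (d : ℝ) * α₀ ^ 2 = (3 * γ ^ 2 * α₀ ^ 6) * (d * (α₀ ^ 4)⁻¹) by field_simp]
    exact mul_le_mul_of_nonneg_right hγL (by positivity)
  have b48 : 48 * L ^ 2 * (d : ℝ) * σ ^ 2 = 48 * (L ^ 2 * (d : ℝ) / α₀ ^ 2) := by
    rw [hσ]
    ring
  unfold deltaSigma
  refine mul_le_mul_of_nonneg_left ?_ (by positivity)
  rw [show 49 * L ^ 2 * (d : ℝ) / α₀ ^ 2 = 49 * (L ^ 2 * (d : ℝ) / α₀ ^ 2) by ring]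
  linarith

theorem theorem4p2 {d : ℕ} (ε : EucSp d → ℝ)
    (ξ : OrthonormalBasis (Fin d) ℝ (EucSp d))
    (L α₀ γ : ℝ) (hL : 0 < L) (hα₀ : 0 < α₀) (hγ : 0 < γ)
    (hε : ∀ (x : EucSp d) (i : Fin d),
      IsHighFreqBandlimited α₀ γ (crossSection ε x (ξ i)))
    (hεuc : UniformContinuous ε) :
    -- the quadrature constant depends only on the noise, its frequency data, the directions and `L`
    ∃ C : ℝ, 0 < C ∧ ∀ (φ : EucSp d → ℝ) (τ : ℝ) (xstar : EucSp d), 0 < τ →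
      HasLipschitzGradient L φ → IsStronglyConvexGrad τ φ → (∀ y, φ xstar ≤ φ y) →
      ∀ M : ℕ, 2 ≤ M →
      -- linear convergence to a neighborhood, for every smoothing radius
      (∀ σ : ℝ, 0 < σ → ∀ x : ℕ → EucSp d,
        IsDGSDescent (1 / (16 * L)) M σ ξ (fun y => φ y + ε y) x →
        ∀ t : ℕ, ‖x (t + 1) - xstar‖ ^ 2 ≤
          (1 - τ / (32 * L)) ^ (t + 1) * ‖x 0 - xstar‖ ^ 2
            + deltaSigma C L τ α₀ γ d M σ) ∧
      -- the choice of the smoothing radius in the high-frequency case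
      (α₀ > L ^ (1 / 3 : ℝ) / (Real.pi * γ ^ (1 / 3 : ℝ)) →
        ∀ σ : ℝ,
          σ = Real.sqrt 3 / (Real.pi * α₀ * Real.sqrt 2) * Real.sqrt (logFactor L α₀ γ) →
          0 < σ ∧
          deltaSigma C L τ α₀ γ d M σ ≤
            (4 / τ ^ 2 + 1 / (4 * L * τ)) *
              (ghTerm C d M σ + 8 * L ^ 2 * (d : ℝ) / α₀ ^ 2
                * (logFactor L α₀ γ + ((logFactor L α₀ γ) ^ 2)⁻¹))) ∧
      -- the choice of the smoothing radius in the low-frequency case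
      (α₀ ≤ L ^ (1 / 3 : ℝ) / (Real.pi * γ ^ (1 / 3 : ℝ)) →
        ∀ σ : ℝ, σ = 1 / α₀ →
          deltaSigma C L τ α₀ γ d M σ ≤
            (4 / τ ^ 2 + 1 / (4 * L * τ)) *
              (ghTerm C d M σ + 49 * L ^ 2 * (d : ℝ) / α₀ ^ 2)) := by
  -- The directions are unit vectors, so all cross sections share the modulus of continuity of `ε`;
  -- hence `C` is independent of `x`, `i` and `φ`.
  have hmod : ∀ s > 0, ∃ δ > 0, ∀ η ∈ {η : ℝ → ℝ | ∃ x i, η = crossSection ε x (ξ i)},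
      ∀ y y' : ℝ, |y - y'| < δ → |η y - η y'| ≤ s := by
    intro s hs
    obtain ⟨δ, hδ, h⟩ := Metric.uniformContinuous_iff.mp hεuc s hs
    refine ⟨δ, hδ, ?_⟩
    rintro _ ⟨x, i, rfl⟩ y y' hy
    refine (Real.dist_eq _ _).symm.trans_le (h ?_).le
    rwa [dist_add_left, dist_eq_norm, ← sub_smul, norm_smul, ξ.orthonormal.1 i, mul_one,
      Real.norm_eq_abs]
  obtain ⟨C, hC, hnoise⟩ := exists_forall_ghDeriv_sq_le hα₀ hγ hL
    (S := {η : ℝ → ℝ | ∃ x i, η = crossSection ε x (ξ i)})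
    (by rintro _ ⟨x, i, rfl⟩; exact hε x i) hmod
  refine ⟨C, hC, fun φ τ xstar hτ hφ hconv hmin M hM => ⟨fun σ hσ x hx t => ?_, ?_, ?_⟩⟩
  · have hD := deltaSigma_nonneg (α₀ := α₀) (γ := γ) hC.le hL.le hτ.le d M hσ.le
    -- In dimension zero there is no unit vector to force `τ ≤ L`, and the contraction factor may be
    -- negative; but all distances vanish.
    rcases Nat.eq_zero_or_pos d with rfl | hd
    · have hsub : ∀ y : EucSp 0, ‖y‖ = 0 := fun y => by rw [Subsingleton.elim y 0, norm_zero]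
      rw [hsub, hsub]
      simpa using hD
    have hτL : τ ≤ L := hconv.le_of_hasLipschitzGradient hφ (ξ.orthonormal.1 ⟨0, hd⟩)
    refine le_pow_mul_add_of_contraction (a := fun t => ‖x t - xstar‖ ^ 2)
      (by rw [div_le_one (by positivity)]; linarith) hD (fun t => ?_) (t + 1)
    rw [hx t]
    refine (norm_inexact_step_sub_sq_le hL hτ hφ hconv hmin (x t) _).trans ?_
    unfold deltaSigma
    gcongr
    refine (norm_dgsGradient_sub_gradient_sq_le hL.le ξ hφ hM hσ (x t)
      (fun i => hnoise M hM σ hσ _ ⟨x t, i, rfl⟩)).trans_eq ?_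
    unfold ghTerm
    ring
  · intro h σ hσ
    refine ⟨?_, deltaSigma_le_of_high_frequency hL hα₀ hγ hτ d M h hσ⟩
    have hℓ := logFactor_pos hL hγ h
    have := Real.pi_pos
    rw [hσ]
    positivity
  · intro h σ hσ
    exact deltaSigma_le_of_low_frequency hL hα₀ hγ hτ d M h hσ
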